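/- Let $F$ be a field of characteristic zero, let $e_{ij}$ be the $2\times 2$ matrix units, and put $M_1=Fe_{22}\oplus Fe_{12}$ and $M_2=Fe_{11}\oplus Fe_{12}$ (associative algebras without unit). Let $\varepsilon,\delta$ be the derivations of $M_1$ given by $\varepsilon(\alpha e_{22}+\beta e_{12})=\beta e_{12}$, $\delta(\alpha e_{22}+\beta e_{12})=\alpha e_{12}$, and denote by the same letters the derivations of $M_2$ given by $\varepsilon(\alpha e_{11}+\beta e_{12})=\beta e_{12}$, $\delta(\alpha e_{11}+\beta e_{12})=\alpha e_{12}$. For $i=1,2$ the Lie algebra $\mathrm{Der}(M_i)$ of all derivations of $M_i$ is a $2$-dimensional metabelian Lie algebra spanned by $\varepsilon$ and $\delta$, with $[\varepsilon,\delta]=\delta$. Let $L$ be a Lie algebra over $F$ acting on $M_1$ and on $M_2$ through isomorphisms $L\cong \mathrm{Der}(M_1)$ and $L\cong\mathrm{Der}(M_2)$, and write $M_1^D$, $M_2^D$ for the resulting $L$-algebras (so that $\varepsilon,\delta$ are also regarded as elements of $L$). Conventions. Let $\mathcal B$ be a basis of the universal enveloping algebra $U(L)$. $F\langle X|L\rangle$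 is the free associative algebra (without unit) on the generators $x_j^{h}$, $h\in\mathcal B$, $j\ge 1$, with $x_j^h$ extended linearly to all $h\in U(L)$, and $x_j=x_j^1$; $L$ acts on it by derivations with $\gamma(x_j^h)=x_j^{\gamma h}$, and this extends to an action of $U(L)$. For an $L$-algebra $A$, $\mathrm{Id}^L(A)$ is the set of $f\in F\langle X|L\rangle$ that vanish under all substitutions $x_j^h\mapsto h(a_j)$, $a_j\in A$. A $T_L$-ideal is a two-sided ideal of $F\langle X|L\rangle$ invariant under the $U(L)$-action and under all endomorphisms commuting with that action, and $\langle S\rangle_{T_L}$ is the smallest $T_L$-ideal containing $S$. $P_n^L$ is the span of the monomials $x_{\sigma(1)}^{h_1}\cdots x_{\sigma(n)}^{h_n}$ with $\sigma\in S_n$, $h_k\in\mathcal B$; the group $S_n$ acts on it by $\sigma(x_i^h)=x_{\sigma(i)}^h$; $c_n^L(A)$ and $\chi_n^L(A)$ are the dimension and the $S_n$-character of $P_n^L/(P_n^L\cap\mathrm{Id}^L(A))$. $\chi_\lambda$ is the irreducible $S_n$-character of the partition $\lambda\vdash n$. Write $x=x_1$, $y=x_2$ and $[x,y]=xy-yx$.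 Theorem. 1. $\mathrm{Id}^L(M_1^D)=\langle xy^{\varepsilon},\ x^{\varepsilon}y-y^{\varepsilon}x-[x,y],\ x^{\varepsilon^2}-x^{\varepsilon},\ x^{\delta\varepsilon},\ x^{\varepsilon\delta}-x^{\delta}\rangle_{T_L}$ and $\mathrm{Id}^L(M_2^D)=\langle x^{\varepsilon}y,\ xy^{\varepsilon}-yx^{\varepsilon}-[x,y],\ x^{\varepsilon^2}-x^{\varepsilon},\ x^{\delta\varepsilon},\ x^{\varepsilon\delta}-x^{\delta}\rangle_{T_L}$. 2. $c_n^L(M_1^D)=c_n^L(M_2^D)=n+2$ for all $n\ge 1$. 3. $\chi_n^L(M_1^D)=\chi_n^L(M_2^D)=3\chi_{(n)}+\chi_{(n-1,1)}$ for all $n\ge 2$, and $\chi_1^L(M_1^D)=\chi_1^L(M_2^D)=3\chi_{(1)}$. -/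

import Mathlib

open Module

noncomputable section

attribute [local instance 100] LieRing.ofAssociativeRing

/-! ### Algebras with derivations -/

section LAlgebras

variable (F : Type*) [Field F] (A : Type*) [NonUnitalRing A] [Module F A]
  [IsScalarTower F A A] [SMulCommClass F A A]

/-- The Lie algebra of all derivations of a (not necessarily unital) associative algebra. -/
def Der : LieSubalgebra F (Module.End F A) where
  carrier := {d | ∀ a b : A, d (a * b) = d a * b + a * d b}
  add_mem' := by
    intro d e hd he a b
    simp only [LinearMap.add_apply, hd a b, he a b, add_mul, mul_add]
    abel
  zero_mem' := by intro a b; simp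
  smul_mem' := by
    intro c d hd a b
    simp only [LinearMap.smul_apply, hd a b, smul_add, smul_mul_assoc, mul_smul_comm]
  lie_mem' := by
    intro d e hd he a b
    simp only [Set.mem_ofPred_eq] at hd he
    simp only [Ring.lie_def, LinearMap.sub_apply, Module.End.mul_apply, hd, he, map_add,
      sub_mul, mul_sub]
    abel

end LAlgebras

section UAction

variable {F : Type*} [Field F] {L : Type*} [LieRing L] [LieAlgebra F L]
  {A : Type*} [NonUnitalRing A] [Module F A] [IsScalarTower F A A] [SMulCommClass F A A]

/-- The extension to the universal enveloping algebra of an action `ρ` of the Lie algebra `L`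
by derivations of `A`. -/
def uAct (ρ : L →ₗ⁅F⁆ Der F A) : UniversalEnvelopingAlgebra F L →ₐ[F] Module.End F A :=
  UniversalEnvelopingAlgebra.lift F ((Der F A).incl.comp ρ)

end UAction

/-! ### The free algebra with derivations

`ι` is the index type of a basis of `U(L)`; the free generators `x_j^{h_i}` are indexed by the
pairs `(j, i)`. As the algebras under consideration need not have a unit, the free associative
algebra is the one without unit, i.e. the linear span of the nonempty words. -/

/-- The free associative algebra `F⟨X|L⟩` on the free generators `x_j^{h_i}`. -/
abbrev FreeDiff (F : Type*) [Field F] (ι : Type*) : Type _ :=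
  MonoidAlgebra F (FreeSemigroup (ℕ × ι))

namespace FreeDiff

section Free

variable {F : Type*} [Field F] {ι : Type*}

/-- The free generator `x_j^{h_i}`, where `p = (j, i)`. -/
def gen (p : ℕ × ι) : FreeDiff F ι := MonoidAlgebra.single (FreeSemigroup.of p) 1

/-- The homomorphism out of the free algebra with prescribed values on the free generators. -/
def lift {A : Type*} [NonUnitalRing A] [Module F A] [IsScalarTower F A A] [SMulCommClass F A A]
    (g : ℕ × ι → A) : FreeDiff F ι →ₙₐ[F] A :=
  MonoidAlgebra.liftMagma F (FreeSemigroup.lift g)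

theorem lift_single {A : Type*} [NonUnitalRing A] [Module F A] [IsScalarTower F A A]
    [SMulCommClass F A A] (g : ℕ × ι → A) (w : FreeSemigroup (ℕ × ι)) (c : F) :
    lift g (MonoidAlgebra.single w c) = c • FreeSemigroup.lift g w := by
  simp [lift, MonoidAlgebra.liftMagma]

@[simp] theorem lift_gen {A : Type*} [NonUnitalRing A] [Module F A] [IsScalarTower F A A]
    [SMulCommClass F A A] (g : ℕ × ι → A) (p : ℕ × ι) :
    lift g (gen p : FreeDiff F ι) = g p := by
  simp [gen, lift_single]

theorem hom_ext {A : Type*} [NonUnitalRing A] [Module F A] [IsScalarTower F A A]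
    [SMulCommClass F A A] {φ ψ : FreeDiff F ι →ₙₐ[F] A}
    (h : ∀ p, φ (gen p) = ψ (gen p)) : φ = ψ := by
  apply (MonoidAlgebra.liftMagma F).symm.injective
  apply FreeSemigroup.hom_ext
  funext p
  exact h p

/-- The value on a nonempty word of the derivation with prescribed values on the letters. -/
def derWord (f : ℕ × ι → FreeDiff F ι) : ℕ × ι → List (ℕ × ι) → FreeDiff F ι
  | p, [] => f p
  | p, q :: l => f p * MonoidAlgebra.single ⟨q, l⟩ 1 + gen p * derWord f q l

/-- The linear extension of `derWord`. -/
def derLin (f : ℕ × ι → FreeDiff F ι) : FreeDiff F ι →ₗ[F] FreeDiff F ι :=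
  (Finsupp.linearCombination F fun w : FreeSemigroup (ℕ × ι) => derWord f w.head w.tail) ∘ₗ
    (MonoidAlgebra.coeffLinearEquiv F).toLinearMap

theorem derLin_single (f : ℕ × ι → FreeDiff F ι) (w : FreeSemigroup (ℕ × ι)) (c : F) :
    derLin f (MonoidAlgebra.single w c) = c • derWord f w.head w.tail := by
  simp [derLin]

@[simp] theorem derLin_gen (f : ℕ × ι → FreeDiff F ι) (p : ℕ × ι) :
    derLin f (gen p) = f p := by
  simp [gen, derLin_single, FreeSemigroup.of, derWord]

theorem derWord_mul (f : ℕ × ι → FreeDiff F ι) (l : List (ℕ × ι)) (p : ℕ × ι)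
    (v : FreeSemigroup (ℕ × ι)) :
    derWord f p (l ++ v.head :: v.tail) =
      derWord f p l * MonoidAlgebra.single v 1 +
        MonoidAlgebra.single ⟨p, l⟩ 1 * derWord f v.head v.tail := by
  induction l generalizing p with
  | nil => rfl
  | cons q l ih =>
    have h1 : (MonoidAlgebra.single ⟨q, l ++ v.head :: v.tail⟩ 1 : FreeDiff F ι) =
        MonoidAlgebra.single ⟨q, l⟩ 1 * MonoidAlgebra.single v 1 := by
      rw [MonoidAlgebra.single_mul_single, one_mul]; rfl
    have h2 : (MonoidAlgebra.single ⟨p, q :: l⟩ 1 : FreeDiff F ι) =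
        gen p * MonoidAlgebra.single ⟨q, l⟩ 1 := by
      rw [gen, MonoidAlgebra.single_mul_single, one_mul]; rfl
    rw [List.cons_append, derWord, derWord, ih, h1, h2]
    simp only [mul_add, add_mul, mul_assoc, add_assoc]

theorem derLin_mul (f : ℕ × ι → FreeDiff F ι) (a b : FreeDiff F ι) :
    derLin f (a * b) = derLin f a * b + a * derLin f b := by
  induction a using MonoidAlgebra.induction_linear with
  | zero => simp
  | add a a' h h' =>
    simp only [add_mul, map_add, h, h']
    abel
  | single w c =>
    induction b using MonoidAlgebra.induction_linear with
    | zero => simp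
    | add b b' h h' =>
      simp only [mul_add, map_add, h, h']
      abel
    | single v d =>
      have e1 : (MonoidAlgebra.single w c : FreeDiff F ι) = c • MonoidAlgebra.single w 1 := by
        simp
      have e2 : (MonoidAlgebra.single v d : FreeDiff F ι) = d • MonoidAlgebra.single v 1 := by
        simp
      have e3 : (w * v) = ⟨w.head, w.tail ++ v.head :: v.tail⟩ := rfl
      rw [e1, e2]
      simp only [smul_mul_assoc, mul_smul_comm, map_smul, MonoidAlgebra.single_mul_single, one_mul,
        e3, derLin_single, one_smul, derWord_mul]
      rw [← smul_add, ← smul_add]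

/-- The derivation of the free algebra with prescribed values on the free generators. -/
def der (f : ℕ × ι → FreeDiff F ι) : Der F (FreeDiff F ι) := ⟨derLin f, derLin_mul f⟩

@[simp] theorem der_gen (f : ℕ × ι → FreeDiff F ι) (p : ℕ × ι) :
    (der f : Module.End F (FreeDiff F ι)) (gen p) = f p := derLin_gen f p

theorem der_ext {d e : Der F (FreeDiff F ι)}
    (h : ∀ p, (d : Module.End F (FreeDiff F ι)) (gen p) =
      (e : Module.End F (FreeDiff F ι)) (gen p)) : d = e := by
  apply Subtype.ext
  apply LinearMap.ext
  intro a
  induction a using MonoidAlgebra.induction_linear with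
  | zero => simp
  | add a b ha hb => simp [ha, hb]
  | single w c =>
    have e1 : (MonoidAlgebra.single w c : FreeDiff F ι) = c • MonoidAlgebra.single w 1 := by
      simp
    rw [e1, map_smul, map_smul]
    congr 1
    induction w using FreeSemigroup.recOnMul with
    | ih1 p => exact h p
    | ih2 p w hp hw =>
      have e2 : (MonoidAlgebra.single (FreeSemigroup.of p * w) 1 : FreeDiff F ι) =
          gen p * MonoidAlgebra.single w 1 := by
        rw [gen, MonoidAlgebra.single_mul_single, one_mul]
      rw [e2, d.2, e.2, h p, hw (by simp)]

/-- The action of the permutations of the variables: `σ (x_j^h) = x_{σ j}^h`. -/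
def permVars : Representation F (Equiv.Perm ℕ) (FreeDiff F ι) where
  toFun σ := ((lift fun p => gen (σ p.1, p.2) : FreeDiff F ι →ₙₐ[F] FreeDiff F ι) :
    FreeDiff F ι →ₗ[F] FreeDiff F ι)
  map_one' := by
    have : (lift fun p => gen ((1 : Equiv.Perm ℕ) p.1, p.2) : FreeDiff F ι →ₙₐ[F] FreeDiff F ι) =
        NonUnitalAlgHom.id F _ := hom_ext fun p => by simp
    rw [this]
    rfl
  map_mul' σ τ := by
    have : (lift fun p => gen ((σ * τ) p.1, p.2) : FreeDiff F ι →ₙₐ[F] FreeDiff F ι) =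
        (lift fun p => gen (σ p.1, p.2)).comp (lift fun p => gen (τ p.1, p.2)) :=
      hom_ext fun p => by simp
    rw [this]
    rfl

/-- The action of `S_n` on the free algebra, by permutations of the first `n` variables. -/
def permFin (n : ℕ) : Representation F (Equiv.Perm (Fin n)) (FreeDiff F ι) :=
  permVars.comp (Equiv.Perm.viaEmbeddingHom Fin.valEmbedding)

variable (F ι) in
/-- The space `P_n^L` of multilinear differential polynomials in the first `n` variables,
spanned by the monomials `x_{σ(1)}^{h_1} ⋯ x_{σ(n)}^{h_n}` with `h_1, …, h_n` in the basis. -/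
def multilinear (n : ℕ) : Submodule F (FreeDiff F ι) :=
  Submodule.span F {f | ∃ (σ : Equiv.Perm (Fin n)) (h : Fin n → ι) (w : FreeSemigroup (ℕ × ι)),
    w.head :: w.tail = List.ofFn (fun k => ((σ k : ℕ), h k)) ∧ f = MonoidAlgebra.single w 1}

theorem permVars_gen (σ : Equiv.Perm ℕ) (p : ℕ × ι) :
    permVars σ (gen p : FreeDiff F ι) = gen (σ p.1, p.2) :=
  lift_gen _ _

theorem permVars_single (σ : Equiv.Perm ℕ) (w : FreeSemigroup (ℕ × ι)) (c : F) :
    permVars σ (MonoidAlgebra.single w c : FreeDiff F ι) =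
      MonoidAlgebra.single (FreeSemigroup.map (Prod.map σ id) w) c := by
  have hl : ∀ v : FreeSemigroup (ℕ × ι),
      FreeSemigroup.lift (fun p => (gen (σ p.1, p.2) : FreeDiff F ι)) v =
        MonoidAlgebra.single (FreeSemigroup.map (Prod.map σ id) v) 1 := by
    intro v
    induction v using FreeSemigroup.recOnMul with
    | ih1 p => simp [gen, Prod.map]
    | ih2 p w _ hw =>
      rw [map_mul, map_mul, hw, FreeSemigroup.lift_of, FreeSemigroup.map_of, gen,
        MonoidAlgebra.single_mul_single, one_mul]
      rfl
  change lift _ _ = _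
  rw [lift_single, hl]
  simp

theorem map_head_tail {α β : Type*} (g : α → β) (w : FreeSemigroup α) :
    (FreeSemigroup.map g w).head :: (FreeSemigroup.map g w).tail =
      (w.head :: w.tail).map g := by
  induction w using FreeSemigroup.recOnMul with
  | ih1 p => rfl
  | ih2 p w _ hw =>
    rw [map_mul, FreeSemigroup.head_mul, FreeSemigroup.tail_mul, hw, FreeSemigroup.map_of]
    simp [FreeSemigroup.of]

theorem multilinear_le_comap (n : ℕ) (σ : Equiv.Perm (Fin n)) :
    multilinear F ι n ≤ (multilinear F ι n).comap (permFin n σ) := by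
  refine Submodule.span_le.2 ?_
  rintro f ⟨τ, h, w, hw, rfl⟩
  refine Submodule.subset_span ⟨σ * τ, h,
    FreeSemigroup.map (Prod.map (Equiv.Perm.viaEmbeddingHom Fin.valEmbedding σ) id) w, ?_, ?_⟩
  · rw [map_head_tail, hw, List.map_ofFn]
    congr 1
    funext k
    have := Equiv.Perm.viaEmbedding_apply σ Fin.valEmbedding (τ k)
    simp only [Fin.valEmbedding_apply] at this
    simp [Equiv.Perm.viaEmbeddingHom_apply, this]
  · exact permVars_single _ _ _

end Free

section Basis

variable {F : Type*} [Field F] {L : Type*} [LieRing L] [LieAlgebra F L] {ι : Type*}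
  (b : Basis ι F (UniversalEnvelopingAlgebra F L))

/-- The differential variable `x_j^h` for an arbitrary `h` in `U(L)`: linear in `h`, and equal to
the free generator `x_j^{h_i}` when `h = h_i` belongs to the basis. -/
def X (j : ℕ) : UniversalEnvelopingAlgebra F L →ₗ[F] FreeDiff F ι :=
  b.constr F fun i => gen (j, i)

@[simp] theorem X_basis (j : ℕ) (i : ι) : X b j (b i) = gen (j, i) := by simp [X]

/-- The derivation of `F⟨X|L⟩` given by `γ ∈ L`: it sends `x_j^h` to `x_j^{γh}`. -/
def actDer (γ : L) : Der F (FreeDiff F ι) :=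
  der fun p => X b p.1 (UniversalEnvelopingAlgebra.ι F γ * b p.2)

theorem actDer_X (γ : L) (j : ℕ) (h : UniversalEnvelopingAlgebra F L) :
    (actDer b γ : Module.End F (FreeDiff F ι)) (X b j h) =
      X b j (UniversalEnvelopingAlgebra.ι F γ * h) := by
  have : (actDer b γ : Module.End F (FreeDiff F ι)) ∘ₗ X b j =
      X b j ∘ₗ LinearMap.mulLeft F (UniversalEnvelopingAlgebra.ι F γ) :=
    b.ext fun i => by simp [actDer]
  exact LinearMap.congr_fun this h

/-- The action of `L` by derivations on `F⟨X|L⟩`. -/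
def act : L →ₗ⁅F⁆ Der F (FreeDiff F ι) where
  toFun := actDer b
  map_add' γ γ' := der_ext fun p => by
    simp [actDer, add_mul]
  map_smul' c γ := der_ext fun p => by
    simp [actDer]
  map_lie' := by
    intro γ γ'
    refine der_ext fun p => ?_
    obtain ⟨j, i⟩ := p
    have e : (gen (j, i) : FreeDiff F ι) = X b j (b i) := (X_basis b j i).symm
    rw [e, actDer_X, LieHom.map_lie]
    simp only [LieSubalgebra.coe_bracket, Ring.lie_def, LinearMap.sub_apply,
      Module.End.mul_apply, actDer_X, sub_mul, mul_assoc, map_sub]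

/-- A `T_L`-ideal of `F⟨X|L⟩`: a two-sided ideal which is invariant under the action of `U(L)` and
under all endomorphisms of `F⟨X|L⟩` commuting with the action of `U(L)`. -/
structure IsTLIdeal (I : Submodule F (FreeDiff F ι)) : Prop where
  mul_mem_left : ∀ f g, g ∈ I → f * g ∈ I
  mul_mem_right : ∀ f g, f ∈ I → f * g ∈ I
  act_mem : ∀ (h : UniversalEnvelopingAlgebra F L) (f), f ∈ I → uAct (act b) h f ∈ I
  map_mem : ∀ ψ : FreeDiff F ι →ₙₐ[F] FreeDiff F ι,
    (∀ (h : UniversalEnvelopingAlgebra F L) (f),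
      ψ (uAct (act b) h f) = uAct (act b) h (ψ f)) → ∀ f, f ∈ I → ψ f ∈ I

/-- The `T_L`-ideal generated by a set of differential polynomials. -/
def spanTL (S : Set (FreeDiff F ι)) : Submodule F (FreeDiff F ι) :=
  sInf {I | IsTLIdeal b I ∧ S ⊆ I}

variable {A : Type*} [NonUnitalRing A] [Module F A] [IsScalarTower F A A] [SMulCommClass F A A]
  (ρ : L →ₗ⁅F⁆ Der F A)

/-- The evaluation of differential polynomials at `x_j = a j` in the `L`-algebra `A`:
the homomorphism sending `x_j^h` to `h (a j)`. -/
def eval (a : ℕ → A) : FreeDiff F ι →ₙₐ[F] A :=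
  lift fun p => uAct ρ (b p.2) (a p.1)

/-- The differential identities `Id^L(A)` of the `L`-algebra `A`. -/
def idL : Submodule F (FreeDiff F ι) where
  carrier := {f | ∀ a : ℕ → A, eval b ρ a f = 0}
  add_mem' hf hg a := by rw [map_add, hf a, hg a, add_zero]
  zero_mem' a := map_zero _
  smul_mem' c f hf a := by rw [map_smul, hf a, smul_zero]

theorem eval_permVars (σ : Equiv.Perm ℕ) (a : ℕ → A) (f : FreeDiff F ι) :
    eval b ρ a (permVars σ f) = eval b ρ (a ∘ σ) f := by
  have : (eval b ρ a).comp (lift fun p => gen (σ p.1, p.2)) = eval b ρ (a ∘ σ) :=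
    hom_ext fun p => by simp [eval]
  exact DFunLike.congr_fun this f

/-- The action of `S_n` on `P_n^L`. -/
def multilinearRep (n : ℕ) : Representation F (Equiv.Perm (Fin n)) (multilinear F ι n) :=
  (permFin n).subrepresentation (multilinear F ι n) (multilinear_le_comap n)

/-- The subspace `P_n^L ∩ Id^L(A)` of `P_n^L`. -/
def multilinearId (n : ℕ) : Submodule F (multilinear F ι n) :=
  (idL b ρ).submoduleOf (multilinear F ι n)

theorem multilinearId_le_comap (n : ℕ) (σ : Equiv.Perm (Fin n)) :
    multilinearId b ρ n ≤ (multilinearId b ρ n).comap (multilinearRep n σ) := by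
  intro f hf a
  exact (eval_permVars b ρ _ a f.1).trans (hf _)

/-- The `S_n`-module `P_n^L(A) = P_n^L / (P_n^L ∩ Id^L(A))`. -/
def quotRep (n : ℕ) :
    Representation F (Equiv.Perm (Fin n)) (multilinear F ι n ⧸ multilinearId b ρ n) :=
  (multilinearRep n).quotient (multilinearId b ρ n) (multilinearId_le_comap b ρ n)

/-- The `n`th differential codimension `c_n^L(A)`. -/
def codim (n : ℕ) : ℕ := Module.finrank F (multilinear F ι n ⧸ multilinearId b ρ n)

/-- The `n`th differential cocharacter `χ_n^L(A)`. -/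
def cochar (n : ℕ) : Equiv.Perm (Fin n) → F := (quotRep b ρ n).character

end Basis

end FreeDiff

/-! ### The irreducible characters of the symmetric groups -/

namespace Specht

variable (F : Type*) [Field F] (n : ℕ) (μ : YoungDiagram)

/-- The action of `S_n` on the row assignments `Fin n → ℕ` (the tabloids of shape `μ` are the row
assignments with `μ.rowLen i` entries in row `i`), extended linearly. -/
def tabloidRep : Representation F (Equiv.Perm (Fin n)) ((Fin n → ℕ) →₀ F) where
  toFun σ := Finsupp.lmapDomain F F fun r k => r (σ⁻¹ k)
  map_one' := by ext; simp
  map_mul' σ τ := by ext; simp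

variable {n μ} in
/-- The polytabloid `e_T = ∑_σ sgn(σ) {σT}` of a tableau `T` of shape `μ`, given as the bijection
from the entries to the cells (row, column) of `μ`; the sum extends over the column stabilizer
of `T`. -/
def polytabloid (T : Fin n ≃ μ.cells) : (Fin n → ℕ) →₀ F :=
  ∑ σ : Equiv.Perm (Fin n) with ∀ k, (T (σ k)).1.2 = (T k).1.2,
    Finsupp.single (fun k => (T (σ⁻¹ k)).1.1) ((Equiv.Perm.sign σ : ℤ) : F)

/-- The Specht module of shape `μ`, where `μ` is a Young diagram with `n` cells. -/
def module : Submodule F ((Fin n → ℕ) →₀ F) :=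
  Submodule.span F (Set.range fun T : Fin n ≃ μ.cells => polytabloid F T)

theorem tabloidRep_polytabloid (σ : Equiv.Perm (Fin n)) (T : Fin n ≃ μ.cells) :
    tabloidRep F n σ (polytabloid F T) = polytabloid F (σ.symm.trans T) := by
  simp only [polytabloid, map_sum]
  refine Finset.sum_bij' (fun τ _ => σ * τ * σ⁻¹) (fun τ _ => σ⁻¹ * τ * σ) ?_ ?_ ?_ ?_ ?_
  · intro τ h
    simp only [Finset.mem_filter, Finset.mem_univ, true_and] at h ⊢
    intro k
    simpa [Equiv.Perm.mul_apply] using h (σ⁻¹ k)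
  · intro τ h
    simp only [Finset.mem_filter, Finset.mem_univ, true_and] at h ⊢
    intro k
    simpa [Equiv.Perm.mul_apply] using h (σ k)
  · intro τ _
    group
  · intro τ _
    group
  · intro τ _
    have hs : Equiv.Perm.sign (σ * τ * σ⁻¹) = Equiv.Perm.sign τ := by
      rw [Equiv.Perm.sign_mul, Equiv.Perm.sign_mul, Equiv.Perm.sign_inv, mul_right_comm,
        Int.units_mul_self, one_mul]
    rw [hs]
    simp only [tabloidRep, MonoidHom.coe_mk, OneHom.coe_mk, Finsupp.lmapDomain_apply,
      Finsupp.mapDomain_single]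
    congr 1
    funext k
    simp [mul_assoc]

theorem module_le_comap (σ : Equiv.Perm (Fin n)) :
    module F n μ ≤ (module F n μ).comap (tabloidRep F n σ) := by
  refine Submodule.span_le.2 ?_
  rintro _ ⟨T, rfl⟩
  exact Submodule.subset_span ⟨σ.symm.trans T, (tabloidRep_polytabloid F n μ σ T).symm⟩

/-- The irreducible character `χ_μ` of `S_n`, where `μ` is a Young diagram with `n` cells. -/
def chi : Equiv.Perm (Fin n) → F :=
  Representation.character (V := module F n μ)
    ((tabloidRep F n).subrepresentation (module F n μ) (module_le_comap F n μ))

end Specht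

/-- The Young diagram of the partition `(n)`. -/
def rowShape (n : ℕ) : YoungDiagram := YoungDiagram.ofRowLens [n] (by
  rw [List.sortedGE_iff_pairwise]
  simp)

/-- The Young diagram of the partition `(n - 1, 1)`, for `n ≥ 2`. -/
def hookShape (n : ℕ) (hn : 2 ≤ n) : YoungDiagram :=
  YoungDiagram.ofRowLens [n - 1, 1] (by
    rw [List.sortedGE_iff_pairwise]
    simp
    omega)

/-! ### The algebras `M₁` and `M₂` and their derivations

The rows and columns of `2 × 2` matrices are numbered `0, 1`, so that `e₁₁`, `e₁₂`, `e₂₂` are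
`single 0 0 1`, `single 0 1 1`, `single 1 1 1`. -/

section Algebras

open Matrix

variable (F : Type*) [Field F]

/-- `M₁ = F e₂₂ ⊕ F e₁₂`. -/
def M₁ : NonUnitalSubalgebra F (Matrix (Fin 2) (Fin 2) F) where
  toSubmodule := Submodule.span F {single 1 1 1, single 0 1 1}
  mul_mem' := by
    intro x y hx hy
    simp only [AddSubsemigroup.mem_carrier, AddSubmonoid.mem_toSubsemigroup,
      Submodule.mem_toAddSubmonoid, Submodule.mem_span_pair] at hx hy ⊢
    obtain ⟨a, c, rfl⟩ := hx
    obtain ⟨a', c', rfl⟩ := hy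
    refine ⟨a * a', c * a', ?_⟩
    ext i j
    fin_cases i <;> fin_cases j <;> simp [Matrix.mul_apply, Matrix.single]

/-- `M₂ = F e₁₁ ⊕ F e₁₂`. -/
def M₂ : NonUnitalSubalgebra F (Matrix (Fin 2) (Fin 2) F) where
  toSubmodule := Submodule.span F {single 0 0 1, single 0 1 1}
  mul_mem' := by
    intro x y hx hy
    simp only [AddSubsemigroup.mem_carrier, AddSubmonoid.mem_toSubsemigroup,
      Submodule.mem_toAddSubmonoid, Submodule.mem_span_pair] at hx hy ⊢
    obtain ⟨a, c, rfl⟩ := hx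
    obtain ⟨a', c', rfl⟩ := hy
    refine ⟨a * a', a * c', ?_⟩
    ext i j
    fin_cases i <;> fin_cases j <;> simp [Matrix.mul_apply, Matrix.single]

variable {F}

theorem mem_M₁ {x : Matrix (Fin 2) (Fin 2) F} :
    x ∈ M₁ F ↔ ∃ a c : F, a • single 1 1 1 + c • single 0 1 1 = x :=
  Submodule.mem_span_pair

theorem mem_M₂ {x : Matrix (Fin 2) (Fin 2) F} :
    x ∈ M₂ F ↔ ∃ a c : F, a • single 0 0 1 + c • single 0 1 1 = x :=
  Submodule.mem_span_pair

theorem e₁₂_mem_M₁ (c : F) : c • single 0 1 1 ∈ M₁ F := mem_M₁.2 ⟨0, c, by simp⟩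

theorem e₁₂_mem_M₂ (c : F) : c • single 0 1 1 ∈ M₂ F := mem_M₂.2 ⟨0, c, by simp⟩

variable (F)

/-- The derivation `ε (α e₂₂ + β e₁₂) = β e₁₂` of `M₁`. -/
def ε₁ : Der F (M₁ F) where
  val :=
    { toFun := fun x => ⟨x.1 0 1 • single 0 1 1, e₁₂_mem_M₁ _⟩
      map_add' := fun x y => Subtype.ext (by simp [add_smul])
      map_smul' := fun c x => Subtype.ext (by simp [mul_smul]) }
  property := by
    rintro ⟨x, hx⟩ ⟨y, hy⟩
    obtain ⟨a, c, rfl⟩ := mem_M₁.1 hx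
    obtain ⟨a', c', rfl⟩ := mem_M₁.1 hy
    apply Subtype.ext
    ext i j
    fin_cases i <;> fin_cases j <;> simp [Matrix.mul_apply, Matrix.single]

/-- The derivation `δ (α e₂₂ + β e₁₂) = α e₁₂` of `M₁`. -/
def δ₁ : Der F (M₁ F) where
  val :=
    { toFun := fun x => ⟨x.1 1 1 • single 0 1 1, e₁₂_mem_M₁ _⟩
      map_add' := fun x y => Subtype.ext (by simp [add_smul])
      map_smul' := fun c x => Subtype.ext (by simp [mul_smul]) }
  property := by
    rintro ⟨x, hx⟩ ⟨y, hy⟩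
    obtain ⟨a, c, rfl⟩ := mem_M₁.1 hx
    obtain ⟨a', c', rfl⟩ := mem_M₁.1 hy
    apply Subtype.ext
    ext i j
    fin_cases i <;> fin_cases j <;> simp [Matrix.mul_apply, Matrix.single]

/-- The derivation `ε (α e₁₁ + β e₁₂) = β e₁₂` of `M₂`. -/
def ε₂ : Der F (M₂ F) where
  val :=
    { toFun := fun x => ⟨x.1 0 1 • single 0 1 1, e₁₂_mem_M₂ _⟩
      map_add' := fun x y => Subtype.ext (by simp [add_smul])
      map_smul' := fun c x => Subtype.ext (by simp [mul_smul]) }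
  property := by
    rintro ⟨x, hx⟩ ⟨y, hy⟩
    obtain ⟨a, c, rfl⟩ := mem_M₂.1 hx
    obtain ⟨a', c', rfl⟩ := mem_M₂.1 hy
    apply Subtype.ext
    ext i j
    fin_cases i <;> fin_cases j <;> simp [Matrix.mul_apply, Matrix.single]

/-- The derivation `δ (α e₁₁ + β e₁₂) = α e₁₂` of `M₂`. -/
def δ₂ : Der F (M₂ F) where
  val :=
    { toFun := fun x => ⟨x.1 0 0 • single 0 1 1, e₁₂_mem_M₂ _⟩
      map_add' := fun x y => Subtype.ext (by simp [add_smul])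
      map_smul' := fun c x => Subtype.ext (by simp [mul_smul]) }
  property := by
    rintro ⟨x, hx⟩ ⟨y, hy⟩
    obtain ⟨a, c, rfl⟩ := mem_M₂.1 hx
    obtain ⟨a', c', rfl⟩ := mem_M₂.1 hy
    apply Subtype.ext
    ext i j
    fin_cases i <;> fin_cases j <;> simp [Matrix.mul_apply, Matrix.single]

end Algebras

end

/-! In coordinates (α, β), the product of `M₁` is x·y = α(y)x, while ε maps (α, β) to (0, β) and δ
maps (α, β) to (0, α). This data is abstracted as `IsRightTriangular`, and everything is proved at
that level. The opposite algebra of `M₂` has the same structure, so the results for `M₂` follow by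
reversing words.

Identities. In U(L), the relations ε² = ε, δε = 0, εδ = δ reduce every exponent to a combination of
1, ε, δ. The relation xy^ε = 0 kills ε, and with it δ, everywhere except on the first letter. It
also turns the swap identity into zxy = zyx, so the letters after the first commute. The swap
identity itself says that x^{1-ε}y is symmetric in x and y; applying δ to it shows the same for x^δ
y. Hence modulo the defining identities every polynomial is a sum of a symmetric word polynomial p
headed by x^{1-ε}, another one q headed by x^δ, and terms x_i^ε t_i with commuting tails t_i
(`HasRelations.sup_eq_top`). Its value at points with coordinates (α_j, β_j) is (p(α), q(α) + Σ
t_i(α)β_i), where p and q are taken without constant term. Over an infinite field this determines p,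
q and the t_i, so no further identities exist (`IsRightTriangular.idL_le`).

Codimensions and cocharacters. A multilinear polynomial has the value (A∏α_j, B∏α_j + Σ C_i
β_i∏_{j≠i}α_j), and every (A, B, C) in F × F × Fⁿ occurs. So the quotient has dimension n + 2, and
S_n fixes A and B and permutes the C_i. Its character is 2 plus the number of fixed points. The
Specht modules of shapes (n) and (n-1,1) have characters 1 and (number of fixed points) - 1, which
gives the stated decomposition (`cochar_eq`, `Specht.chi_hookShape`). -/

section Foundations

attribute [local instance 100] LieRing.ofAssociativeRing

/-! ### Generation of U(L) by L and induction on its elements. -/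

namespace UniversalEnvelopingAlgebra

variable {F : Type*} [Field F] {L : Type*} [LieRing L] [LieAlgebra F L]

/-- By the universal property, the map of L into the subalgebra S it generates extends to U(L) → S.
Followed by the inclusion it agrees with the identity on L, hence everywhere, so S is all of U(L).
-/
theorem adjoin_range_ι :
    Algebra.adjoin F (Set.range (ι F : L → UniversalEnvelopingAlgebra F L)) = ⊤ := by
  set S := Algebra.adjoin F (Set.range (ι F : L → UniversalEnvelopingAlgebra F L)) with hS
  let g : L →ₗ⁅F⁆ S :=
    { toFun := fun x => ⟨ι F x, Algebra.subset_adjoin ⟨x, rfl⟩⟩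
      map_add' := fun x y => Subtype.ext (by simp only [map_add]; rfl)
      map_smul' := fun c x => Subtype.ext (by simp only [map_smul]; rfl)
      map_lie' := fun {x y} => Subtype.ext (by
        simp only [LieHom.map_lie, Ring.lie_def]; rfl) }
  have h : S.val.comp (lift F g) = AlgHom.id F _ := by
    refine hom_ext F (LieHom.ext fun x => ?_)
    change ((lift F g (ι F x) : S) : UniversalEnvelopingAlgebra F L) = ι F x
    rw [lift_ι_apply]
    rfl
  refine eq_top_iff.2 fun x _ => ?_
  have := DFunLike.congr_fun h x
  change ((lift F g x : S) : UniversalEnvelopingAlgebra F L) = x at this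
  rw [← this]
  exact (lift F g x).2

/-- Induction on elements of `U(L)`. -/
theorem induction_on {p : UniversalEnvelopingAlgebra F L → Prop}
    (hι : ∀ x, p (ι F x)) (hc : ∀ c : F, p (algebraMap F _ c))
    (ha : ∀ x y, p x → p y → p (x + y)) (hm : ∀ x y, p x → p y → p (x * y))
    (x : UniversalEnvelopingAlgebra F L) : p x := by
  have hx : x ∈ Algebra.adjoin F (Set.range (ι F : L → UniversalEnvelopingAlgebra F L)) := by
    rw [adjoin_range_ι]; trivial
  induction hx using Algebra.adjoin_induction with
  | mem x h => obtain ⟨y, rfl⟩ := h; exact hι y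
  | algebraMap r => exact hc r
  | add x y _ _ h h' => exact ha x y h h'
  | mul x y _ _ h h' => exact hm x y h h'

end UniversalEnvelopingAlgebra

/-! ### Evaluations of differential polynomials and T_L-ideals. -/

namespace FreeDiff

variable {F : Type*} [Field F] {L : Type*} [LieRing L] [LieAlgebra F L] {ι : Type*}
  (b : Basis ι F (UniversalEnvelopingAlgebra F L))
  {A : Type*} [NonUnitalRing A] [Module F A] [IsScalarTower F A A] [SMulCommClass F A A]
  (ρ : L →ₗ⁅F⁆ Der F A)

theorem uAct_ι (γ : L) : uAct ρ (UniversalEnvelopingAlgebra.ι F γ) = (ρ γ : Module.End F A) :=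
  UniversalEnvelopingAlgebra.lift_ι_apply _ _ _

theorem uAct_ι_mul (γ : L) (x y : A) :
    uAct ρ (UniversalEnvelopingAlgebra.ι F γ) (x * y) =
      uAct ρ (UniversalEnvelopingAlgebra.ι F γ) x * y +
        x * uAct ρ (UniversalEnvelopingAlgebra.ι F γ) y := by
  rw [uAct_ι]
  exact (ρ γ).2 x y

theorem uAct_mul (h k : UniversalEnvelopingAlgebra F L) (x : A) :
    uAct ρ (h * k) x = uAct ρ h (uAct ρ k x) := by
  rw [map_mul, Module.End.mul_apply]

theorem uAct_one (x : A) : uAct ρ 1 x = x := by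
  rw [map_one, Module.End.one_apply]

theorem uAct_act_X (h : UniversalEnvelopingAlgebra F L) (j : ℕ)
    (k : UniversalEnvelopingAlgebra F L) : uAct (act b) h (X b j k) = X b j (h * k) := by
  induction h using UniversalEnvelopingAlgebra.induction_on generalizing k with
  | hι γ => rw [uAct_ι]; exact actDer_X b γ j k
  | hc c => simp [Algebra.algebraMap_eq_smul_one]
  | ha x y hx hy => rw [map_add, LinearMap.add_apply, hx, hy, add_mul, map_add]
  | hm x y hx hy => rw [uAct_mul, hy, hx, mul_assoc]

theorem eval_X (a : ℕ → A) (j : ℕ) (h : UniversalEnvelopingAlgebra F L) :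
    eval b ρ a (X b j h) = uAct ρ h (a j) := by
  have : ((eval b ρ a : FreeDiff F ι →ₙₐ[F] A) : FreeDiff F ι →ₗ[F] A) ∘ₗ X b j =
      LinearMap.applyₗ (a j) ∘ₗ (uAct ρ).toLinearMap :=
    b.ext fun i => by simp [eval]
  exact LinearMap.congr_fun this h

/-- Induction on U(L) reduces to an element of L. It acts by derivations on both sides, so the claim
passes from the free generators to words. -/
theorem eval_uAct (a : ℕ → A) (h : UniversalEnvelopingAlgebra F L) (f : FreeDiff F ι) :
    eval b ρ a (uAct (act b) h f) = uAct ρ h (eval b ρ a f) := by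
  induction h using UniversalEnvelopingAlgebra.induction_on generalizing f with
  | hι γ =>
    induction f using MonoidAlgebra.induction_linear with
    | zero => simp
    | add f g hf hg => simp only [map_add, hf, hg]
    | single w c =>
      have e1 : (MonoidAlgebra.single w c : FreeDiff F ι) = c • MonoidAlgebra.single w 1 := by
        simp
      rw [e1]
      simp only [map_smul]
      congr 1
      induction w using FreeSemigroup.recOnMul with
      | ih1 p =>
        have : (MonoidAlgebra.single (FreeSemigroup.of p) 1 : FreeDiff F ι) =
            X b p.1 (b p.2) := (X_basis b p.1 p.2).symm
        rw [this, uAct_act_X, eval_X, eval_X, uAct_mul]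
      | ih2 p w hp hw =>
        have e2 : (MonoidAlgebra.single (FreeSemigroup.of p * w) 1 : FreeDiff F ι) =
            MonoidAlgebra.single (FreeSemigroup.of p) 1 * MonoidAlgebra.single w 1 := by
          rw [MonoidAlgebra.single_mul_single, one_mul]
        rw [e2, uAct_ι_mul, map_add, map_mul, map_mul, map_mul, uAct_ι_mul, hp (by simp),
          hw (by simp)]
  | hc c => simp only [AlgHom.commutes, Module.algebraMap_end_apply, map_smul]
  | ha x y hx hy => simp only [map_add, LinearMap.add_apply, hx, hy]
  | hm x y hx hy => simp only [uAct_mul, hx, hy]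

theorem isTLIdeal_idL : IsTLIdeal b (idL b ρ) where
  mul_mem_left f g hg a := by rw [map_mul, hg a, mul_zero]
  mul_mem_right f g hf a := by rw [map_mul, hf a, zero_mul]
  act_mem h f hf a := by rw [eval_uAct, hf a, map_zero]
  map_mem ψ hψ f hf a := by
    -- An endomorphism commuting with U(L) is determined by the images of the x_j, so composing it
    -- with an evaluation gives another evaluation.
    have : (eval b ρ a).comp ψ = eval b ρ fun j => eval b ρ a (ψ (X b j 1)) :=
      hom_ext fun p => by
        rw [← X_basis b p.1 p.2, eval_X, ← eval_uAct, ← hψ, uAct_act_X, mul_one]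
        rfl
    exact (DFunLike.congr_fun this f).trans (hf _)

theorem isTLIdeal_spanTL (S : Set (FreeDiff F ι)) : IsTLIdeal b (spanTL b S) where
  mul_mem_left f g hg := by
    simp only [spanTL, Submodule.mem_sInf] at hg ⊢
    exact fun I hI => hI.1.mul_mem_left f g (hg I hI)
  mul_mem_right f g hg := by
    simp only [spanTL, Submodule.mem_sInf] at hg ⊢
    exact fun I hI => hI.1.mul_mem_right f g (hg I hI)
  act_mem h f hf := by
    simp only [spanTL, Submodule.mem_sInf] at hf ⊢
    exact fun I hI => hI.1.act_mem h f (hf I hI)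
  map_mem ψ hψ f hf := by
    simp only [spanTL, Submodule.mem_sInf] at hf ⊢
    exact fun I hI => hI.1.map_mem ψ hψ f (hf I hI)

theorem subset_spanTL (S : Set (FreeDiff F ι)) : S ⊆ spanTL b S := by
  intro f hf
  simp only [spanTL, SetLike.mem_coe, Submodule.mem_sInf]
  exact fun I hI => hI.2 hf

theorem spanTL_le {S : Set (FreeDiff F ι)} {I : Submodule F (FreeDiff F ι)}
    (hI : IsTLIdeal b I) (h : S ⊆ I) : spanTL b S ≤ I :=
  sInf_le ⟨hI, h⟩

/-- A `T_L`-ideal is closed under the substitutions `x_j ↦ g_j`. -/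
theorem IsTLIdeal.subst_mem {I : Submodule F (FreeDiff F ι)} (hI : IsTLIdeal b I)
    (g : ℕ → FreeDiff F ι) {f : FreeDiff F ι} (hf : f ∈ I) : eval b (act b) g f ∈ I :=
  hI.map_mem _ (fun h f => eval_uAct b (act b) g h f) f hf

end FreeDiff

end Foundations

/-! ### Normal forms modulo the defining identities. -/

section Identities

attribute [local instance 100] LieRing.ofAssociativeRing

namespace UniversalEnvelopingAlgebra

variable {F : Type*} [Field F] {L : Type*} [LieRing L] [LieAlgebra F L]

/-- If `L` is spanned by `e` and `d`, then modulo `e² = e`, `de = 0`, `ed = d` every element of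
`U(L)` is a linear combination of `1`, `e` and `d`. -/
theorem exists_sub_mem {e d : L} (hs : ∀ γ : L, ∃ s t : F, γ = s • e + t • d)
    {J : Submodule F (UniversalEnvelopingAlgebra F L)}
    (hl : ∀ h k, k ∈ J → h * k ∈ J) (hr : ∀ h k, h ∈ J → h * k ∈ J)
    (hee : ι F e * ι F e - ι F e ∈ J) (hde : ι F d * ι F e ∈ J)
    (hed : ι F e * ι F d - ι F d ∈ J) (h : UniversalEnvelopingAlgebra F L) :
    ∃ c₁ c₂ c₃ : F, h - (c₁ • 1 + c₂ • ι F e + c₃ • ι F d) ∈ J := by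
  -- The relation d² ≡ 0 is not assumed but follows from d² = (de)d - d(ed - d).
  have hdd : ι F d * ι F d ∈ J := by
    have := J.sub_mem (hr _ (ι F d) hde) (hl (ι F d) _ hed)
    rwa [mul_sub, mul_assoc, sub_sub_cancel] at this
  -- The claim is strengthened to left multiplication by h preserving reducible elements, so that
  -- products in the induction are handled by composition.
  suffices key : ∀ w, (∃ c₁ c₂ c₃ : F, w - (c₁ • 1 + c₂ • ι F e + c₃ • ι F d) ∈ J) →
      ∃ c₁ c₂ c₃ : F, h * w - (c₁ • 1 + c₂ • ι F e + c₃ • ι F d) ∈ J by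
    simpa using key 1 ⟨1, 0, 0, by simp⟩
  induction h using induction_on with
  | hι γ =>
    rintro w ⟨c₁, c₂, c₃, hw⟩
    obtain ⟨s, t, rfl⟩ := hs γ
    refine ⟨0, s * c₁ + s * c₂, t * c₁ + s * c₃, ?_⟩
    have := J.add_mem (hl (ι F (s • e + t • d)) _ hw)
      (J.add_mem (J.add_mem (J.smul_mem (s * c₂) hee) (J.smul_mem (s * c₃) hed))
        (J.add_mem (J.smul_mem (t * c₂) hde) (J.smul_mem (t * c₃) hdd)))
    convert this using 1
    simp only [map_add, map_smul, mul_sub, add_mul, mul_add, smul_mul_assoc, mul_smul_comm,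
      mul_one]
    module
  | hc c =>
    rintro w ⟨c₁, c₂, c₃, hw⟩
    refine ⟨c * c₁, c * c₂, c * c₃, ?_⟩
    convert J.smul_mem c hw using 1
    rw [Algebra.algebraMap_eq_smul_one, smul_mul_assoc, one_mul]
    module
  | ha x y hx hy =>
    intro w hw
    obtain ⟨c₁, c₂, c₃, h₁⟩ := hx w hw
    obtain ⟨c₁', c₂', c₃', h₂⟩ := hy w hw
    refine ⟨c₁ + c₁', c₂ + c₂', c₃ + c₃', ?_⟩
    convert J.add_mem h₁ h₂ using 1
    rw [add_mul]
    module
  | hm x y hx hy =>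
    intro w hw
    rw [mul_assoc]
    exact hx _ (hy w hw)

end UniversalEnvelopingAlgebra

namespace FreeDiff

variable {F : Type*} [Field F] {L : Type*} [LieRing L] [LieAlgebra F L] {ι : Type*}
  (b : Basis ι F (UniversalEnvelopingAlgebra F L))

/-- Right multiplication by the product of the variables in a list. -/
noncomputable def mulVars : List ℕ → FreeDiff F ι →ₗ[F] FreeDiff F ι
  | [] => LinearMap.id
  | j :: l => mulVars l ∘ₗ LinearMap.mulRight F (X b j 1)

theorem mulVars_cons (j : ℕ) (l : List ℕ) (f : FreeDiff F ι) :
    mulVars b (j :: l) f = mulVars b l (f * X b j 1) := rfl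

theorem mulVars_append_singleton (l : List ℕ) (j : ℕ) (f : FreeDiff F ι) :
    mulVars b (l ++ [j]) f = mulVars b l f * X b j 1 := by
  induction l generalizing f with
  | nil => rfl
  | cons i l ih => rw [List.cons_append, mulVars_cons, ih, mulVars_cons]

/-- The word `x_i^k x_{j₁} ⋯ x_{jₘ}` for a list `i, j₁, …, jₘ`, and `0` for the empty list. -/
noncomputable def headWord (k : UniversalEnvelopingAlgebra F L) : List ℕ → FreeDiff F ι
  | [] => 0
  | i :: l => mulVars b l (X b i k)

/-- The linear map sending a monomial to a linear arrangement of it headed by `x_i^k`. -/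
noncomputable def headPoly (k : UniversalEnvelopingAlgebra F L) :
    MvPolynomial ℕ F →ₗ[F] FreeDiff F ι :=
  (MvPolynomial.basisMonomials ℕ F).constr F fun m => headWord b k (Finsupp.toMultiset m).toList

/-- The linear map sending a monomial `m` to `f` times a linear arrangement of `m`. -/
noncomputable def tailPoly (f : FreeDiff F ι) : MvPolynomial ℕ F →ₗ[F] FreeDiff F ι :=
  (MvPolynomial.basisMonomials ℕ F).constr F fun m => mulVars b (Finsupp.toMultiset m).toList f

theorem headPoly_monomial (k : UniversalEnvelopingAlgebra F L) (m : ℕ →₀ ℕ) :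
    headPoly b k (MvPolynomial.monomial m 1) = headWord b k (Finsupp.toMultiset m).toList := by
  exact Basis.constr_basis _ _ _ m

theorem tailPoly_monomial (f : FreeDiff F ι) (m : ℕ →₀ ℕ) :
    tailPoly b f (MvPolynomial.monomial m 1) = mulVars b (Finsupp.toMultiset m).toList f := by
  exact Basis.constr_basis _ _ _ m

theorem headPoly_C (k : UniversalEnvelopingAlgebra F L) (c : F) :
    headPoly b k (MvPolynomial.C c) = 0 := by
  have : (MvPolynomial.C c : MvPolynomial ℕ F) = c • MvPolynomial.monomial 0 1 := by
    rw [MvPolynomial.smul_monomial, smul_eq_mul, mul_one]; rfl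
  rw [this, map_smul, headPoly_monomial]
  simp [headWord]

variable (ε δ : UniversalEnvelopingAlgebra F L)

/-- A `T_L`-ideal containing the defining identities of `M₁`. -/
structure HasRelations (I : Submodule F (FreeDiff F ι)) : Prop extends IsTLIdeal b I where
  mul_ε : X b 0 1 * X b 1 ε ∈ I
  swap_ε : X b 0 ε * X b 1 1 - X b 1 ε * X b 0 1 -
    (X b 0 1 * X b 1 1 - X b 1 1 * X b 0 1) ∈ I
  ε_ε : X b 0 (ε ^ 2) - X b 0 ε ∈ I
  δ_ε : X b 0 (δ * ε) ∈ I
  ε_δ : X b 0 (ε * δ) - X b 0 δ ∈ I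

namespace HasRelations

variable {b ε δ} {I : Submodule F (FreeDiff F ι)}

theorem mul_act_ε (h : HasRelations b ε δ I) (f g : FreeDiff F ι) :
    f * uAct (act b) ε g ∈ I := by
  have := h.subst_mem b (fun j => if j = 0 then f else g) h.mul_ε
  simpa [eval_X, uAct_one] using this

theorem swap_act_ε (h : HasRelations b ε δ I) (f g : FreeDiff F ι) :
    uAct (act b) ε f * g - uAct (act b) ε g * f - (f * g - g * f) ∈ I := by
  have := h.subst_mem b (fun j => if j = 0 then f else g) h.swap_ε
  simpa [eval_X, uAct_one] using this

theorem act_ε_ε (h : HasRelations b ε δ I) (f : FreeDiff F ι) :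
    uAct (act b) (ε * ε - ε) f ∈ I := by
  have := h.subst_mem b (fun _ => f) h.ε_ε
  rwa [map_sub, eval_X, eval_X, pow_two, ← LinearMap.sub_apply, ← map_sub] at this

theorem act_δ_ε (h : HasRelations b ε δ I) (f : FreeDiff F ι) :
    uAct (act b) (δ * ε) f ∈ I := by
  have := h.subst_mem b (fun _ => f) h.δ_ε
  rwa [eval_X] at this

theorem act_ε_δ (h : HasRelations b ε δ I) (f : FreeDiff F ι) :
    uAct (act b) (ε * δ - δ) f ∈ I := by
  have := h.subst_mem b (fun _ => f) h.ε_δ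
  rwa [map_sub, eval_X, eval_X, ← LinearMap.sub_apply, ← map_sub] at this

/-- Since δg ≡ ε(δg), the identity fε(g') ≡ 0 applies with g' = δg. -/
theorem mul_act_δ (h : HasRelations b ε δ I) (f g : FreeDiff F ι) :
    f * uAct (act b) δ g ∈ I := by
  have := I.sub_mem (h.mul_act_ε f (uAct (act b) δ g)) (h.mul_mem_left f _ (h.act_ε_δ g))
  rwa [map_sub, LinearMap.sub_apply, mul_sub, uAct_mul, sub_sub_cancel] at this

/-- In f times the swap identity for g and k, the terms with ε vanish because ε no longer sits on
the first factor. What remains is f[g, k] ≡ 0. -/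
theorem mul_swap (h : HasRelations b ε δ I) (f g k : FreeDiff F ι) :
    f * g * k - f * k * g ∈ I := by
  have h1 := h.mul_mem_left f _ (h.swap_act_ε g k)
  have h2 := I.sub_mem (h.mul_mem_right _ k (h.mul_act_ε f g))
    (h.mul_mem_right _ g (h.mul_act_ε f k))
  convert I.sub_mem h2 h1 using 1
  simp only [mul_sub, mul_assoc]
  abel

/-- Apply the derivation δ to the swap identity: the terms containing δε vanish, and so do those
with δ on the second factor. -/
theorem swap_act_δ {d : L} (h : HasRelations b ε (UniversalEnvelopingAlgebra.ι F d) I)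
    (f g : FreeDiff F ι) :
    uAct (act b) (UniversalEnvelopingAlgebra.ι F d) f * g -
      uAct (act b) (UniversalEnvelopingAlgebra.ι F d) g * f ∈ I := by
  set δ := UniversalEnvelopingAlgebra.ι F d with hδ
  have h1 := h.act_mem δ _ (h.swap_act_ε f g)
  simp only [map_sub, hδ, uAct_ι_mul] at h1
  rw [← hδ, ← uAct_mul, ← uAct_mul] at h1
  have h2 := h.mul_mem_right _ g (h.act_δ_ε f)
  have h3 := h.mul_mem_right _ f (h.act_δ_ε g)
  have h4 := h.mul_act_δ (uAct (act b) ε f) g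
  have h5 := h.mul_act_δ (uAct (act b) ε g) f
  have h6 := h.mul_act_δ f g
  have h7 := h.mul_act_δ g f
  convert I.sub_mem (I.add_mem (I.add_mem h2 h4) h7)
    (I.add_mem h1 (I.add_mem (I.add_mem h3 h5) h6)) using 1
  abel

theorem mulVars_mem (h : HasRelations b ε δ I) (l : List ℕ) {f : FreeDiff F ι} (hf : f ∈ I) :
    mulVars b l f ∈ I := by
  induction l generalizing f with
  | nil => exact hf
  | cons j l ih => exact ih (h.mul_mem_right _ _ hf)

theorem mulVars_perm (h : HasRelations b ε δ I) {l l' : List ℕ} (hl : l.Perm l')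
    (f : FreeDiff F ι) : mulVars b l f - mulVars b l' f ∈ I := by
  induction hl generalizing f with
  | nil => simp
  | cons x _ ih => exact ih _
  | swap x y l =>
    simp only [mulVars_cons, ← map_sub]
    exact h.mulVars_mem l (h.mul_swap _ _ _)
  | trans _ _ ih ih' => simpa using I.add_mem (ih f) (ih' f)

/-- Tail letters always commute modulo I. The hypothesis `hk` supplies the one missing
transposition, that of the head with its neighbour, so the word depends only on the multiset of its
variables. -/
theorem headWord_perm (h : HasRelations b ε δ I) {k : UniversalEnvelopingAlgebra F L}
    (hk : ∀ i j, X b i k * X b j 1 - X b j k * X b i 1 ∈ I) {l l' : List ℕ} (hl : l.Perm l') :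
    headWord b k l - headWord b k l' ∈ I := by
  induction hl with
  | nil => simp
  | cons x hl _ => exact h.mulVars_perm hl _
  | swap x y l =>
    simp only [headWord, mulVars_cons, ← map_sub]
    exact h.mulVars_mem l (hk _ _)
  | trans _ _ ih ih' => simpa using I.add_mem ih ih'

theorem headWord_mem_sup (h : HasRelations b ε δ I) {k : UniversalEnvelopingAlgebra F L}
    (hk : ∀ i j, X b i k * X b j 1 - X b j k * X b i 1 ∈ I) (l : List ℕ) :
    headWord b k l ∈ I ⊔ LinearMap.range (headPoly b k) := by
  have hp : l.Perm (Finsupp.toMultiset (Multiset.toFinsupp (l : Multiset ℕ))).toList := by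
    rw [← Multiset.coe_eq_coe]
    simp
  rw [← sub_add_cancel (headWord b k l) (headWord b k _)]
  exact Submodule.add_mem_sup (h.headWord_perm hk hp) ⟨_, headPoly_monomial b k _⟩

theorem mulVars_mem_sup (h : HasRelations b ε δ I) (f : FreeDiff F ι) (l : List ℕ) :
    mulVars b l f ∈ I ⊔ LinearMap.range (tailPoly b f) := by
  have hp : l.Perm (Finsupp.toMultiset (Multiset.toFinsupp (l : Multiset ℕ))).toList := by
    rw [← Multiset.coe_eq_coe]
    simp
  rw [← sub_add_cancel (mulVars b l f) (mulVars b _ f)]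
  exact Submodule.add_mem_sup (h.mulVars_perm hp f) ⟨_, tailPoly_monomial b f _⟩

end HasRelations

/-- A submodule containing the free generators and closed under right multiplication by them is
the whole free algebra. -/
theorem eq_top_of_mul_gen_mem {W : Submodule F (FreeDiff F ι)} (h1 : ∀ p, gen p ∈ W)
    (h2 : ∀ p, ∀ f ∈ W, f * gen p ∈ W) : W = ⊤ := by
  have key : ∀ w : FreeSemigroup (ℕ × ι), MonoidAlgebra.single w (1 : F) ∈ W ∧
      ∀ f ∈ W, f * MonoidAlgebra.single w (1 : F) ∈ W := by
    intro w
    induction w using FreeSemigroup.recOnMul with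
    | ih1 p => exact ⟨h1 p, h2 p⟩
    | ih2 p w hp hw =>
      have e : (MonoidAlgebra.single (FreeSemigroup.of p * w) 1 : FreeDiff F ι) =
          MonoidAlgebra.single (FreeSemigroup.of p) 1 * MonoidAlgebra.single w 1 := by
        rw [MonoidAlgebra.single_mul_single, one_mul]
      rw [e]
      refine ⟨hw.2 _ hp.1, fun f hf => ?_⟩
      rw [← mul_assoc]
      exact hw.2 _ (hp.2 f hf)
  refine eq_top_iff.2 fun f _ => ?_
  induction f using MonoidAlgebra.induction_linear with
  | zero => exact W.zero_mem
  | add f g hf hg => exact W.add_mem (hf trivial) (hg trivial)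
  | single w c =>
    have e1 : (MonoidAlgebra.single w c : FreeDiff F ι) = c • MonoidAlgebra.single w 1 := by
      simp
    rw [e1]
    exact W.smul_mem _ (key w).1

theorem HasRelations.X_decomp {e d : L} (hs : ∀ γ : L, ∃ s t : F, γ = s • e + t • d)
    {I : Submodule F (FreeDiff F ι)}
    (h : HasRelations b (UniversalEnvelopingAlgebra.ι F e) (UniversalEnvelopingAlgebra.ι F d) I)
    (k : UniversalEnvelopingAlgebra F L) : ∃ c₁ c₂ c₃ : F, ∀ j,
      X b j k - (c₁ • X b j 1 + c₂ • X b j (UniversalEnvelopingAlgebra.ι F e) +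
        c₃ • X b j (UniversalEnvelopingAlgebra.ι F d)) ∈ I := by
  -- J consists of the operators sending the whole free algebra into I; it is a two-sided ideal
  -- containing the relations on ε and δ.
  let J : Submodule F (UniversalEnvelopingAlgebra F L) :=
    { carrier := {k | ∀ f, uAct (act b) k f ∈ I}
      add_mem' := fun hx hy f => by
        rw [map_add, LinearMap.add_apply]; exact I.add_mem (hx f) (hy f)
      zero_mem' := fun f => by simp
      smul_mem' := fun c x hx f => by
        rw [map_smul, LinearMap.smul_apply]; exact I.smul_mem c (hx f) }
  obtain ⟨c₁, c₂, c₃, hc⟩ := UniversalEnvelopingAlgebra.exists_sub_mem hs (J := J)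
    (fun x y hy f => by rw [uAct_mul]; exact h.act_mem _ _ (hy f))
    (fun x y hx f => by rw [uAct_mul]; exact hx _) h.act_ε_ε h.act_δ_ε h.act_ε_δ k
  refine ⟨c₁, c₂, c₃, fun j => ?_⟩
  have := hc (X b j 1)
  rw [uAct_act_X, mul_one] at this
  simpa using this

/-- Modulo the defining identities of `M₁`, every differential polynomial has a normal form. -/
theorem HasRelations.sup_eq_top {e d : L} (hs : ∀ γ : L, ∃ s t : F, γ = s • e + t • d)
    {I : Submodule F (FreeDiff F ι)}
    (h : HasRelations b (UniversalEnvelopingAlgebra.ι F e) (UniversalEnvelopingAlgebra.ι F d) I) :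
    I ⊔ (LinearMap.range (headPoly b (1 - UniversalEnvelopingAlgebra.ι F e)) ⊔
      LinearMap.range (headPoly b (UniversalEnvelopingAlgebra.ι F d)) ⊔
      ⨆ i, LinearMap.range (tailPoly b (X b i (UniversalEnvelopingAlgebra.ι F e)))) = ⊤ := by
  set ε := UniversalEnvelopingAlgebra.ι F e with hε
  set δ := UniversalEnvelopingAlgebra.ι F d with hδ
  set V := LinearMap.range (headPoly b (1 - ε)) ⊔ LinearMap.range (headPoly b δ) ⊔
      ⨆ i, LinearMap.range (tailPoly b (X b i ε)) with hV
  let S : Set (FreeDiff F ι) :=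
    {f | ∃ i l, f = mulVars b l (X b i 1) ∨ f = mulVars b l (X b i ε) ∨
      f = mulVars b l (X b i δ)}
  have hS : ∀ i l, mulVars b l (X b i 1) ∈ I ⊔ Submodule.span F S ∧
      mulVars b l (X b i ε) ∈ I ⊔ Submodule.span F S ∧
      mulVars b l (X b i δ) ∈ I ⊔ Submodule.span F S := fun i l =>
    ⟨Submodule.mem_sup_right (Submodule.subset_span ⟨i, l, Or.inl rfl⟩),
      Submodule.mem_sup_right (Submodule.subset_span ⟨i, l, Or.inr (Or.inl rfl)⟩),
      Submodule.mem_sup_right (Submodule.subset_span ⟨i, l, Or.inr (Or.inr rfl)⟩)⟩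
  -- Only the first letter can retain an exponent ε or δ; all later letters reduce to multiples of
  -- plain variables.
  have htop : I ⊔ Submodule.span F S = ⊤ := by
    apply eq_top_of_mul_gen_mem
    · rintro ⟨j, i⟩
      obtain ⟨c₁, c₂, c₃, hc⟩ := h.X_decomp b hs (b i)
      rw [← X_basis b, ← sub_add_cancel (X b j (b i)) _]
      have := hS j []
      exact Submodule.add_mem _ (Submodule.mem_sup_left (hc j)) (Submodule.add_mem _
        (Submodule.add_mem _ (Submodule.smul_mem _ _ this.1) (Submodule.smul_mem _ _ this.2.1))
        (Submodule.smul_mem _ _ this.2.2))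
    · rintro ⟨j, i⟩ f hf
      obtain ⟨c₁, c₂, c₃, hc⟩ := h.X_decomp b hs (b i)
      rw [← X_basis b]
      have hx : f * X b j (b i) - c₁ • (f * X b j 1) ∈ I := by
        have h1 := h.mul_mem_left f _ (hc j)
        have h2 := I.smul_mem c₂ (h.mul_act_ε f (X b j 1))
        have h3 := I.smul_mem c₃ (h.mul_act_δ f (X b j 1))
        rw [uAct_act_X, mul_one] at h2 h3
        convert I.add_mem (I.add_mem h1 h2) h3 using 1
        simp only [mul_sub, mul_add, mul_smul_comm]
        abel
      rw [← sub_add_cancel (f * X b j (b i)) (c₁ • (f * X b j 1))]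
      refine Submodule.add_mem _ (Submodule.mem_sup_left hx) (Submodule.smul_mem _ _ ?_)
      obtain ⟨g, hg, s, hs, rfl⟩ := Submodule.mem_sup.1 hf
      rw [add_mul]
      refine Submodule.add_mem _ (Submodule.mem_sup_left (h.mul_mem_right _ _ hg)) ?_
      clear hf hx
      induction hs using Submodule.span_induction with
      | zero => rw [zero_mul]; exact Submodule.zero_mem _
      | add x y hx' hy' hx hy =>
        rw [add_mul]
        exact Submodule.add_mem _ hx hy
      | smul c x hx' hx =>
        rw [smul_mul_assoc]
        exact Submodule.smul_mem _ _ hx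
      | mem x hx =>
        obtain ⟨i, l, rfl | rfl | rfl⟩ := hx <;> rw [← mulVars_append_singleton]
        exacts [(hS _ _).1, (hS _ _).2.1, (hS _ _).2.2]
  rw [eq_top_iff, ← htop]
  refine sup_le le_sup_left (Submodule.span_le.2 ?_)
  have hεV : ∀ i l, mulVars b l (X b i ε) ∈ I ⊔ V := fun i l =>
    sup_le_sup_left ((le_iSup (fun i => LinearMap.range (tailPoly b (X b i ε))) i).trans
      le_sup_right) I (h.mulVars_mem_sup (X b i ε) l)
  rintro f ⟨i, l, rfl | rfl | rfl⟩
  -- Write x_i = x_i^{1-ε} + x_i^ε. The first part is symmetric with its neighbour, because its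
  -- commutation relation is the negative of the swap identity; the second part is already in normal
  -- form.
  · have h1 : headWord b (1 - ε) (i :: l) ∈ I ⊔ V := by
      refine sup_le_sup_left (le_sup_left.trans le_sup_left) I (h.headWord_mem_sup ?_ _)
      intro i j
      have := I.neg_mem (h.swap_act_ε (X b i 1) (X b j 1))
      simp only [uAct_act_X, mul_one] at this
      convert this using 1
      simp only [map_sub, sub_mul]
      abel
    have h2 := Submodule.add_mem _ h1 (hεV i l)
    rwa [headWord, ← map_add, map_sub, sub_add_cancel] at h2
  · exact hεV i l
  · refine sup_le_sup_left (le_sup_right.trans le_sup_left) I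
      (h.headWord_mem_sup (k := δ) ?_ (i :: l))
    intro i j
    have := h.swap_act_δ (X b i 1) (X b j 1)
    rwa [uAct_act_X, uAct_act_X, mul_one] at this

end FreeDiff

end Identities

/-! ### Evaluation of the normal forms and completeness of the identities. -/

section RightTriangular

attribute [local instance 100] LieRing.ofAssociativeRing

namespace FreeDiff

variable {F : Type*} [Field F] {L : Type*} [LieRing L] [LieAlgebra F L] {ι : Type*}
  (b : Basis ι F (UniversalEnvelopingAlgebra F L))
  {A : Type*} [NonUnitalRing A] [Module F A] [IsScalarTower F A A] [SMulCommClass F A A]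

/-- The `L`-algebra `A` has the structure of `M₁` in the coordinates `κ = (α, β)`. -/
structure IsRightTriangular (κ : A ≃ₗ[F] F × F) (ρ : L →ₗ⁅F⁆ Der F A) (e d : L) : Prop where
  mul_eq : ∀ x y, x * y = (κ y).1 • x
  exists_smul : ∀ γ : L, ∃ s t : F, γ = s • e + t • d
  act_e : ∀ x, κ ((ρ e : Module.End F A) x) = (0, (κ x).2)
  act_d : ∀ x, κ ((ρ d : Module.End F A) x) = (0, (κ x).1)

namespace IsRightTriangular

variable {b} {κ : A ≃ₗ[F] F × F} {ρ : L →ₗ⁅F⁆ Der F A} {e d : L}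

local notation "ε" => UniversalEnvelopingAlgebra.ι F e
local notation "δ" => UniversalEnvelopingAlgebra.ι F d

theorem uAct_e (h : IsRightTriangular κ ρ e d) (x : A) : κ (uAct ρ ε x) = (0, (κ x).2) := by
  rw [uAct_ι, h.act_e]

theorem uAct_d (h : IsRightTriangular κ ρ e d) (x : A) : κ (uAct ρ δ x) = (0, (κ x).1) := by
  rw [uAct_ι, h.act_d]

theorem uAct_one_sub_e (h : IsRightTriangular κ ρ e d) (x : A) :
    κ (uAct ρ (1 - ε) x) = ((κ x).1, 0) := by
  rw [map_sub, LinearMap.sub_apply, uAct_one, map_sub, h.uAct_e]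
  ext <;> simp

/-- The algebra satisfies the defining identities of `M₁`. -/
theorem hasRelations_idL (h : IsRightTriangular κ ρ e d) :
    HasRelations b ε δ (idL b ρ) where
  toIsTLIdeal := isTLIdeal_idL b ρ
  mul_ε a := by
    rw [map_mul, eval_X, eval_X, h.mul_eq, h.uAct_e, zero_smul]
  swap_ε a := by
    apply κ.injective
    simp only [map_sub, map_mul, eval_X, uAct_one, h.mul_eq, map_smul, h.uAct_e]
    ext
    · simp
      ring
    · simp
  ε_ε a := by
    apply κ.injective
    rw [map_sub, eval_X, eval_X, pow_two, uAct_mul, map_sub, h.uAct_e, h.uAct_e]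
    simp
  δ_ε a := by
    apply κ.injective
    rw [eval_X, uAct_mul, h.uAct_d, h.uAct_e]
    simp
  ε_δ a := by
    apply κ.injective
    rw [map_sub, eval_X, eval_X, uAct_mul, map_sub, h.uAct_e, h.uAct_d]
    simp

theorem eval_mulVars (h : IsRightTriangular κ ρ e d) (a : ℕ → A) (l : List ℕ)
    (f : FreeDiff F ι) :
    eval b ρ a (mulVars b l f) = (l.map fun j => (κ (a j)).1).prod • eval b ρ a f := by
  induction l generalizing f with
  | nil => simp [mulVars]
  | cons j l ih =>
    rw [mulVars_cons, ih, map_mul, eval_X, uAct_one, h.mul_eq, smul_smul, List.map_cons,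
      List.prod_cons, mul_comm]

theorem eval_toList (α : ℕ → F) (m : ℕ →₀ ℕ) :
    ((Finsupp.toMultiset m).toList.map α).prod =
      MvPolynomial.eval α (MvPolynomial.monomial m 1) := by
  rw [← Multiset.prod_coe, ← Multiset.map_coe, Multiset.coe_toList, Finsupp.toMultiset_map,
    Finsupp.prod_toMultiset, MvPolynomial.eval_monomial, one_mul,
    Finsupp.prod_mapDomain_index (fun _ => pow_zero _) (fun _ _ _ => pow_add _ _ _)]

theorem eval_tailPoly (h : IsRightTriangular κ ρ e d) (a : ℕ → A) (f : FreeDiff F ι)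
    (p : MvPolynomial ℕ F) :
    eval b ρ a (tailPoly b f p) = MvPolynomial.eval (fun j => (κ (a j)).1) p • eval b ρ a f := by
  induction p using MvPolynomial.induction_on' with
  | monomial m c =>
    have : (MvPolynomial.monomial m c : MvPolynomial ℕ F) = c • MvPolynomial.monomial m 1 := by
      rw [MvPolynomial.smul_monomial, smul_eq_mul, mul_one]
    rw [this, map_smul, tailPoly_monomial, map_smul, h.eval_mulVars, eval_toList,
      MvPolynomial.smul_eval, smul_smul]
  | add p q hp hq => rw [map_add, map_add, hp, hq, map_add, add_smul]

/-- If k sends x to α(x)v, a word headed by x_i^k takes the value v times the product of all its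
α's, the head included. The constant term drops out because the empty word is assigned 0. -/
theorem eval_headPoly (h : IsRightTriangular κ ρ e d) {k : UniversalEnvelopingAlgebra F L}
    {v : F × F} (hk : ∀ x, κ (uAct ρ k x) = (κ x).1 • v) (a : ℕ → A) (p : MvPolynomial ℕ F) :
    κ (eval b ρ a (headPoly b k p)) =
      (MvPolynomial.eval (fun j => (κ (a j)).1) p - p.coeff 0) • v := by
  induction p using MvPolynomial.induction_on' with
  | monomial m c =>
    have : (MvPolynomial.monomial m c : MvPolynomial ℕ F) = c • MvPolynomial.monomial m 1 := by
      rw [MvPolynomial.smul_monomial, smul_eq_mul, mul_one]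
    rw [this, map_smul, headPoly_monomial, map_smul, map_smul, MvPolynomial.smul_eval,
      MvPolynomial.coeff_smul, smul_eq_mul, ← mul_sub, mul_smul, ← eval_toList,
      MvPolynomial.coeff_monomial]
    congr 1
    by_cases hm : m = 0
    · subst hm
      simp [headWord]
    · rw [if_neg hm, sub_zero]
      obtain ⟨i, l, hl⟩ := List.exists_cons_of_ne_nil
        (l := (Finsupp.toMultiset m).toList) (by
          rw [Ne, Multiset.toList_eq_nil]
          exact fun h0 => hm (Multiset.toFinsupp.symm.injective (h0.trans (map_zero _).symm)))
      rw [hl, headWord, h.eval_mulVars, eval_X, map_smul, hk, smul_smul, List.map_cons,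
        List.prod_cons, mul_comm]
  | add p q hp hq =>
    rw [map_add, map_add, map_add, hp, hq, map_add, MvPolynomial.coeff_add, ← add_smul]
    congr 1
    ring

/-- The defining identities of `M₁` imply all its identities. -/
theorem idL_le [Infinite F] (h : IsRightTriangular κ ρ e d) {I : Submodule F (FreeDiff F ι)}
    (hI : HasRelations b ε δ I) (hle : I ≤ idL b ρ) : idL b ρ ≤ I := by
  intro f hf
  have hmem : f ∈ (⊤ : Submodule F (FreeDiff F ι)) := trivial
  rw [← hI.sup_eq_top b h.exists_smul] at hmem
  obtain ⟨g, hg, r, hr, rfl⟩ := Submodule.mem_sup.1 hmem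
  refine I.add_mem hg ?_
  replace hf : ∀ a, eval b ρ a r = 0 := fun a => by simpa [hle hg a] using hf a
  obtain ⟨s, hs, v, hv, rfl⟩ := Submodule.mem_sup.1 hr
  obtain ⟨_, ⟨p, rfl⟩, _, ⟨q, rfl⟩, rfl⟩ := Submodule.mem_sup.1 hs
  obtain ⟨v, hv', rfl⟩ := (Submodule.mem_iSup_iff_exists_finsupp _ _).1 hv
  choose t ht using fun i => LinearMap.mem_range.1 (hv' i)
  have hk1 : ∀ x, κ (uAct ρ (1 - ε) x) = (κ x).1 • ((1 : F), (0 : F)) := fun x => by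
    rw [h.uAct_one_sub_e]; simp
  have hk2 : ∀ x, κ (uAct ρ δ x) = (κ x).1 • ((0 : F), (1 : F)) := fun x => by
    rw [h.uAct_d]; simp
  -- The two coordinates of the vanishing value at the points (α_j, β_j). Taking β = 0 isolates q,
  -- and then β equal to a unit vector isolates each tail polynomial.
  have key : ∀ α β : ℕ → F, MvPolynomial.eval α p - p.coeff 0 = 0 ∧
      MvPolynomial.eval α q - q.coeff 0 +
        ∑ i ∈ v.support, MvPolynomial.eval α (t i) * β i = 0 := by
    intro α β
    have h1 := congrArg κ (hf fun j => κ.symm (α j, β j))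
    rw [map_add, map_add, map_add, map_add, map_zero, h.eval_headPoly hk1, h.eval_headPoly hk2,
      Finsupp.sum, map_sum, map_sum] at h1
    have h2 : ∀ i, κ (eval b ρ (fun j => κ.symm (α j, β j)) (v i)) =
        (0, MvPolynomial.eval α (t i) * β i) := by
      intro i
      rw [← ht i, h.eval_tailPoly, map_smul, eval_X, h.uAct_e]
      simp
    simp only [h2, LinearEquiv.apply_symm_apply] at h1
    have h3 := congrArg Prod.fst h1
    have h4 := congrArg Prod.snd h1
    simp [Prod.fst_sum, Prod.snd_sum] at h3 h4
    exact ⟨h3, h4⟩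
  have hp : p = MvPolynomial.C (p.coeff 0) := MvPolynomial.funext fun α => by
    rw [MvPolynomial.eval_C]
    exact sub_eq_zero.1 (key α 0).1
  have hq : q = MvPolynomial.C (q.coeff 0) := MvPolynomial.funext fun α => by
    rw [MvPolynomial.eval_C]
    have := (key α 0).2
    simp only [Pi.zero_apply, mul_zero, Finset.sum_const_zero, add_zero] at this
    exact sub_eq_zero.1 this
  -- Comparing β = 0 with the i-th unit vector gives t_i(α) = 0 for all α, hence t_i = 0 as F is
  -- infinite.
  have hv : v = 0 := by
    ext1 i
    by_contra hi
    have hi' : i ∈ v.support := Finsupp.mem_support_iff.2 hi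
    have : t i = 0 := MvPolynomial.funext fun α => by
      have h1 := (key α 0).2
      have h2 := (key α (Pi.single i 1)).2
      simp only [Pi.zero_apply, mul_zero, Finset.sum_const_zero, add_zero] at h1
      rw [h1, zero_add, Finset.sum_eq_single i (fun j _ hj => by simp [hj])
        (fun h => absurd hi' h)] at h2
      simpa using h2
    exact hi (by rw [← ht i, this, map_zero]; rfl)
  rw [hp, hq, hv, headPoly_C, headPoly_C]
  simp

end IsRightTriangular

end FreeDiff

end RightTriangular

/-! ### The characters of the Specht modules of shapes (n) and (n-1,1). -/

section SpechtCharacters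

theorem LinearMap.trace_id_of_finrank_eq_one {F M : Type*} [Field F] [AddCommGroup M] [Module F M]
    (h : finrank F M = 1) : LinearMap.trace F M LinearMap.id = 1 := by
  have := FiniteDimensional.of_finrank_pos (K := F) (V := M) (by omega)
  rw [LinearMap.trace_id, h, Nat.cast_one]

namespace Specht

variable {F : Type*} [Field F] {n : ℕ}

theorem mem_rowShape {c : ℕ × ℕ} : c ∈ rowShape n ↔ c.1 = 0 ∧ c.2 < n := by
  rw [rowShape, YoungDiagram.mem_ofRowLens]
  constructor
  · rintro ⟨h, h'⟩
    have h0 : c.1 = 0 := by simpa using h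
    exact ⟨h0, by simpa [h0] using h'⟩
  · rintro ⟨h, h'⟩
    exact ⟨by simp [h], by simpa [h] using h'⟩

theorem mem_hookShape {hn : 2 ≤ n} {c : ℕ × ℕ} :
    c ∈ hookShape n hn ↔ c.1 = 0 ∧ c.2 < n - 1 ∨ c = (1, 0) := by
  rw [hookShape, YoungDiagram.mem_ofRowLens]
  obtain ⟨i, j⟩ := c
  constructor
  · rintro ⟨h, h'⟩
    match i, h, h' with
    | 0, _, h' => exact Or.inl ⟨rfl, by simpa using h'⟩
    | 1, _, h' => exact Or.inr (by simpa using h')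
  · rintro (⟨rfl, h⟩ | h)
    · exact ⟨by simp, by simpa using h⟩
    · simp only [Prod.mk.injEq] at h
      obtain ⟨rfl, rfl⟩ := h
      exact ⟨by simp, by simp⟩

/-- All columns have one cell, so the column stabilizer is trivial; the only tabloid puts every
entry in row 0. -/
theorem polytabloid_rowShape (T : Fin n ≃ (rowShape n).cells) :
    polytabloid F T = Finsupp.single 0 1 := by
  have hrow : ∀ k, (T k).1.1 = 0 := fun k => (mem_rowShape.1 ((T k).2)).1
  have hf : (Finset.univ.filter fun σ : Equiv.Perm (Fin n) =>
      ∀ k, (T (σ k)).1.2 = (T k).1.2) = {1} := by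
    ext σ
    simp only [Finset.mem_filter, Finset.mem_univ, true_and, Finset.mem_singleton]
    constructor
    · intro h
      ext1 k
      exact T.injective (Subtype.ext (Prod.ext ((hrow _).trans (hrow _).symm) (h k)))
    · rintro rfl k
      rfl
  rw [polytabloid, hf, Finset.sum_singleton]
  simp only [Equiv.Perm.sign_one, Units.val_one, Int.cast_one, hrow]
  rfl

theorem chi_rowShape (σ : Equiv.Perm (Fin n)) : chi F n (rowShape n) σ = 1 := by
  let T : Fin n ≃ (rowShape n).cells :=
    { toFun := fun k => ⟨(0, k), mem_rowShape.2 ⟨rfl, k.2⟩⟩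
      invFun := fun c => ⟨c.1.2, (mem_rowShape.1 c.2).2⟩
      left_inv := fun k => rfl
      right_inv := fun c => Subtype.ext (Prod.ext (mem_rowShape.1 c.2).1.symm rfl) }
  have hM : module F n (rowShape n) = F ∙ (Finsupp.single 0 1 : (Fin n → ℕ) →₀ F) := by
    rw [module]
    congr 1
    ext f
    simp only [Set.mem_range, polytabloid_rowShape, Set.mem_singleton_iff]
    exact ⟨fun ⟨_, h⟩ => h.symm, fun h => ⟨T, h.symm⟩⟩
  have hid : (tabloidRep F n).subrepresentation (module F n (rowShape n))
      (module_le_comap F n _) σ = LinearMap.id := by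
    ext1 ⟨x, hx⟩
    apply Subtype.ext
    change tabloidRep F n σ x = x
    rw [hM] at hx
    obtain ⟨c, rfl⟩ := Submodule.mem_span_singleton.1 hx
    rw [map_smul]
    congr 1
    simp only [tabloidRep, MonoidHom.coe_mk, OneHom.coe_mk, Finsupp.lmapDomain_apply,
      Finsupp.mapDomain_single]
    rfl
  rw [chi, Representation.character, hid]
  have h1 : finrank F (module F n (rowShape n)) = 1 := by
    rw [hM, finrank_span_singleton (by simp)]
  exact LinearMap.trace_id_of_finrank_eq_one (M := module F n (rowShape n)) h1

/-- The tabloid of shape `(n - 1, 1)` with `k` in the second row. -/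
noncomputable def hookTabloid (F : Type*) [Field F] {n : ℕ} (k : Fin n) : (Fin n → ℕ) →₀ F :=
  Finsupp.single (Pi.single k 1) 1

theorem tabloidRep_hookTabloid (σ : Equiv.Perm (Fin n)) (k : Fin n) :
    tabloidRep F n σ (hookTabloid F k) = hookTabloid F (σ k) := by
  simp only [tabloidRep, hookTabloid, MonoidHom.coe_mk, OneHom.coe_mk, Finsupp.lmapDomain_apply,
    Finsupp.mapDomain_single]
  congr 1
  funext m
  simp only [Pi.single_apply, Equiv.Perm.inv_eq_iff_eq]

theorem hookTabloid_apply (k m : Fin n) :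
    hookTabloid F k (Pi.single m 1) = if k = m then 1 else 0 := by
  classical
  rw [hookTabloid, Finsupp.single_apply]
  refine if_congr ⟨fun h => ?_, fun h => by rw [h]⟩ rfl rfl
  by_contra hk
  have := congrFun h k
  simp [hk] at this

/-- Only the first column has two cells, so the column stabilizer consists of the identity and the
transposition of its entries k (below) and l (above). -/
theorem polytabloid_hookShape (hn : 2 ≤ n) (T : Fin n ≃ (hookShape n hn).cells) :
    ∃ k l, k ≠ l ∧ polytabloid F T = hookTabloid F k - hookTabloid F l := by
  have h00 : ((0, 0) : ℕ × ℕ) ∈ (hookShape n hn).cells :=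
    mem_hookShape.2 (Or.inl ⟨rfl, by simp; omega⟩)
  have h10 : ((1, 0) : ℕ × ℕ) ∈ (hookShape n hn).cells := mem_hookShape.2 (Or.inr rfl)
  set k := T.symm ⟨_, h10⟩ with hk
  set l := T.symm ⟨_, h00⟩ with hl
  have hTk : (T k).1 = (1, 0) := by simp [hk]
  have hTl : (T l).1 = (0, 0) := by simp [hl]
  have hT : ∀ m, m ≠ k → (T m).1.1 = 0 := by
    intro m hm
    rcases mem_hookShape.1 (T m).2 with h | h
    · exact h.1
    · exact absurd (T.injective (Subtype.ext (h.trans hTk.symm))) hm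
  have hT' : ∀ m, m ≠ k → m ≠ l → (T m).1.2 ≠ 0 := fun m hm hm' h =>
    hm' (T.injective (Subtype.ext ((Prod.ext (hT m hm) h : (T m).1 = (0, 0)).trans hTl.symm)))
  have hkl : k ≠ l := by
    intro h
    rw [h, hTl] at hTk
    simp at hTk
  have hrow : ∀ m, (T m).1.1 = (Pi.single k 1 : Fin n → ℕ) m := by
    intro m
    rcases eq_or_ne m k with rfl | h
    · simp [hTk]
    · simp [hT m h, h]
  have hf : (Finset.univ.filter fun σ : Equiv.Perm (Fin n) =>
      ∀ k, (T (σ k)).1.2 = (T k).1.2) = {1, Equiv.swap k l} := by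
    ext σ
    simp only [Finset.mem_filter, Finset.mem_univ, true_and, Finset.mem_insert,
      Finset.mem_singleton]
    constructor
    · intro h
      have hσ : ∀ m, m ≠ k → m ≠ l → σ m = m := by
        intro m hm hm'
        have h1 : σ m ≠ k := fun e => hT' m hm hm' (by rw [← h m, e, hTk])
        exact T.injective (Subtype.ext (Prod.ext ((hT _ h1).trans (hT _ hm).symm) (h m)))
      have hk' : σ k = k ∨ σ k = l := by
        by_contra hc
        push Not at hc
        exact hc.1 (σ.injective (hσ _ hc.1 hc.2))
      have hl' : σ l = k ∨ σ l = l := by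
        by_contra hc
        push Not at hc
        exact hc.2 (σ.injective (hσ _ hc.1 hc.2))
      have hne : σ k ≠ σ l := fun e => hkl (σ.injective e)
      rcases hk' with h1 | h1
      · left
        ext1 m
        rcases eq_or_ne m k with rfl | hm
        · exact h1
        rcases eq_or_ne m l with rfl | hm'
        · exact hl'.resolve_left fun e => hne (h1.trans e.symm)
        · exact hσ m hm hm'
      · right
        ext1 m
        rcases eq_or_ne m k with rfl | hm
        · rw [h1, Equiv.swap_apply_left]
        rcases eq_or_ne m l with rfl | hm'
        · rw [Equiv.swap_apply_right]
          exact hl'.resolve_right fun e => hne (h1.trans e.symm)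
        · rw [hσ m hm hm', Equiv.swap_apply_of_ne_of_ne hm hm']
    · rintro (rfl | rfl) m
      · rfl
      · rcases eq_or_ne m k with rfl | hm
        · rw [Equiv.swap_apply_left, hTk, hTl]
        rcases eq_or_ne m l with rfl | hm'
        · rw [Equiv.swap_apply_right, hTk, hTl]
        · rw [Equiv.swap_apply_of_ne_of_ne hm hm']
  refine ⟨k, l, hkl, ?_⟩
  have h1 : (1 : Equiv.Perm (Fin n)) ≠ Equiv.swap k l := fun e =>
    hkl (by simpa using DFunLike.congr_fun e k)
  have hswap : (fun m => (Pi.single k 1 : Fin n → ℕ) (Equiv.swap k l m)) = Pi.single l 1 := by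
    funext m
    simp only [Pi.single_apply, Equiv.swap_apply_eq_iff, Equiv.swap_apply_left]
  rw [polytabloid, hf, Finset.sum_pair h1]
  simp only [hrow, Equiv.Perm.sign_one, Equiv.Perm.sign_swap hkl, Equiv.swap_inv, inv_one,
    Equiv.Perm.one_apply, hswap, Units.val_one, Units.val_neg, Int.cast_neg, Int.cast_one,
    Finsupp.single_neg, ← sub_eq_add_neg, hookTabloid]

theorem exists_hookTableau (hn : 2 ≤ n) : Nonempty (Fin n ≃ (hookShape n hn).cells) := by
  refine ⟨Equiv.ofBijective (fun k : Fin n => if h : (k : ℕ) < n - 1 then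
    ⟨(0, (k : ℕ)), mem_hookShape.2 (Or.inl ⟨rfl, h⟩)⟩
    else ⟨(1, 0), mem_hookShape.2 (Or.inr rfl)⟩) ⟨fun k m h => ?_, fun c => ?_⟩⟩
  · have hk := k.2
    have hm := m.2
    ext
    dsimp only at h
    split_ifs at h <;> simp at h <;> omega
  · obtain ⟨⟨i, j⟩, hc⟩ := c
    rcases mem_hookShape.1 hc with ⟨h, h'⟩ | h
    · dsimp only at h h'
      subst h
      refine ⟨⟨j, by omega⟩, ?_⟩
      simp [h']
    · refine ⟨⟨n - 1, by omega⟩, ?_⟩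
      simp [h]

/-- One polytabloid is such a difference for some pair, and S_n is 2-transitive. The permutation
used first moves k' to k and then the image of l' to l, without disturbing k. -/
theorem hookTabloid_sub_mem (hn : 2 ≤ n) (k l : Fin n) :
    hookTabloid F k - hookTabloid F l ∈ module F n (hookShape n hn) := by
  rcases eq_or_ne k l with rfl | hkl
  · rw [sub_self]
    exact Submodule.zero_mem _
  obtain ⟨T⟩ := exists_hookTableau hn
  obtain ⟨k', l', hkl', hT⟩ := polytabloid_hookShape (F := F) hn T
  have hmem : hookTabloid F k' - hookTabloid F l' ∈ module F n (hookShape n hn) :=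
    hT ▸ Submodule.subset_span ⟨T, rfl⟩
  have hs : Equiv.swap k' k l' ≠ k := fun h => hkl' (by
    exact ((Equiv.swap k' k).injective (h.trans (Equiv.swap_apply_left k' k).symm)).symm)
  have := module_le_comap F n (hookShape n hn)
    (Equiv.swap (Equiv.swap k' k l') l * Equiv.swap k' k) hmem
  rwa [Submodule.mem_comap, map_sub, tabloidRep_hookTabloid, tabloidRep_hookTabloid,
    Equiv.Perm.mul_apply, Equiv.Perm.mul_apply, Equiv.swap_apply_left k' k,
    Equiv.swap_apply_left, Equiv.swap_apply_of_ne_of_ne hs.symm hkl] at this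

end Specht

theorem LinearMap.trace_pi_eq_sum {F ι : Type*} [Field F] [Fintype ι] [DecidableEq ι]
    (f : (ι → F) →ₗ[F] ι → F) : LinearMap.trace F _ f = ∑ k, f (Pi.single k 1) k := by
  rw [LinearMap.trace_eq_matrix_trace F (Pi.basisFun F ι), Matrix.trace]
  simp

/-- The trace of an endomorphism of a retract of `F^ι`. -/
theorem LinearMap.trace_eq_sum_of_retract {F ι M : Type*} [Field F] [Fintype ι] [DecidableEq ι]
    [AddCommGroup M] [Module F M] [FiniteDimensional F M] (i : M →ₗ[F] ι → F)
    (q : (ι → F) →ₗ[F] M) (h : ∀ s, q (i s) = s) (R : M →ₗ[F] M) :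
    LinearMap.trace F M R = ∑ k, i (R (q (Pi.single k 1))) k := by
  -- Cyclicity of the trace moves q to the right and turns the trace into one on F^ι.
  have hR : R = q ∘ₗ (i ∘ₗ R) := LinearMap.ext fun s => (h (R s)).symm
  rw [hR, LinearMap.trace_comp_comm', LinearMap.trace_pi_eq_sum]
  simp [h]

namespace Specht

variable {F : Type*} [Field F] {n : ℕ}

/-- The character of the Specht module of shape `(n - 1, 1)`. -/
theorem chi_hookShape [CharZero F] (hn : 2 ≤ n) (σ : Equiv.Perm (Fin n)) :
    chi F n (hookShape n hn) σ = (∑ k, if σ k = k then 1 else 0) - 1 := by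
  set S := module F n (hookShape n hn) with hS
  have hn0 : (n : F) ≠ 0 := by
    rw [Nat.cast_ne_zero]
    omega
  have : FiniteDimensional F S := FiniteDimensional.span_of_finite F (Set.finite_range _)
  let i : S →ₗ[F] Fin n → F :=
    LinearMap.pi fun k => Finsupp.lapply (Pi.single k 1) ∘ₗ S.subtype
  -- The projection of Fⁿ onto vectors of coordinate sum zero, written as e_k ↦ e_k - n⁻¹Σ e_l so
  -- that its values are visibly combinations of differences of tabloids.
  let q₀ : (Fin n → F) →ₗ[F] (Fin n → ℕ) →₀ F :=
    ∑ k, ∑ l, (LinearMap.proj k).smulRight ((n : F)⁻¹ • (hookTabloid F k - hookTabloid F l))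
  have hq₀ : ∀ v, q₀ v =
      ∑ k, ∑ l, v k • (n : F)⁻¹ • (hookTabloid F k - hookTabloid F l) := fun v => by
    simp [q₀, LinearMap.sum_apply]
  let q : (Fin n → F) →ₗ[F] S := q₀.codRestrict S fun v => by
    rw [hq₀]
    exact Submodule.sum_mem _ fun k _ => Submodule.sum_mem _ fun l _ =>
      Submodule.smul_mem _ _ (Submodule.smul_mem _ _ (hookTabloid_sub_mem hn k l))
  have hsingle : ∀ k, q₀ (Pi.single k 1) =
      ∑ l, (n : F)⁻¹ • (hookTabloid F k - hookTabloid F l) := fun k => by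
    rw [hq₀, Finset.sum_eq_single k (fun m _ hm => by simp [hm]) (by simp)]
    simp
  have hqi : ∀ s : S, q (i s) = s := by
    rintro ⟨s, hs⟩
    apply Subtype.ext
    change q₀ (fun k => s (Pi.single k 1)) = s
    rw [hS, module] at hs
    induction hs using Submodule.span_induction with
    | zero => exact map_zero q₀
    | add x y _ _ hx hy => exact (map_add q₀ _ _).trans (by rw [hx, hy])
    | smul c x _ hx => exact (map_smul q₀ c _).trans (by rw [hx])
    | mem x hx =>
      obtain ⟨T, rfl⟩ := hx
      obtain ⟨k, l, -, hT⟩ := polytabloid_hookShape (F := F) hn T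
      have : (fun m => polytabloid F T (Pi.single m 1)) = Pi.single k 1 - Pi.single l 1 := by
        funext m
        rw [hT, Finsupp.sub_apply, hookTabloid_apply, hookTabloid_apply]
        simp [Pi.single_apply, eq_comm]
      rw [this, map_sub, hsingle, hsingle, ← Finset.sum_sub_distrib]
      refine Eq.trans ?_ hT.symm
      simp only [← smul_sub, sub_sub_sub_cancel_right, Finset.sum_const, Finset.card_univ,
        Fintype.card_fin]
      rw [← Nat.cast_smul_eq_nsmul F, smul_smul, mul_inv_cancel₀ hn0, one_smul]
  set R := (tabloidRep F n).subrepresentation S (module_le_comap F n _) σ with hR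
  have hiR : ∀ s k, i (R s) k = i s (σ⁻¹ k) := by
    rintro ⟨s, hs⟩ k
    change Finsupp.mapDomain (fun (r : Fin n → ℕ) m => r (σ⁻¹ m)) s (Pi.single k 1) =
      s (Pi.single (σ⁻¹ k) 1)
    have hinj : Function.Injective fun (r : Fin n → ℕ) (m : Fin n) => r (σ⁻¹ m) := by
      intro r r' h
      funext m
      simpa using congrFun h (σ m)
    have hs : (Pi.single k 1 : Fin n → ℕ) = fun m => (Pi.single (σ⁻¹ k) 1 : Fin n → ℕ) (σ⁻¹ m) := by
      funext m
      simp [Pi.single_apply]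
    rw [hs]
    exact Finsupp.mapDomain_apply hinj s _
  refine (LinearMap.trace_eq_sum_of_retract (M := S) i q hqi R).trans ?_
  -- The diagonal entry of the permutation matrix of σ composed with the projection; the n terms n⁻¹
  -- add up to the 1 that is subtracted.
  have hterm : ∀ k, i (R (q (Pi.single k 1))) k =
      (if σ k = k then 1 else 0) - (n : F)⁻¹ := by
    intro k
    rw [hiR]
    change q₀ (Pi.single k 1) (Pi.single (σ⁻¹ k) 1) = _
    rw [hsingle, Finsupp.finsetSum_apply]
    simp only [Finsupp.smul_apply, Finsupp.sub_apply, hookTabloid_apply, smul_eq_mul]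
    rw [← Finset.mul_sum, Finset.sum_sub_distrib]
    simp only [Finset.sum_ite_eq', Finset.mem_univ, if_true, Finset.sum_const, Finset.card_univ,
      Fintype.card_fin, nsmul_eq_mul, mul_sub, mul_one]
    rw [← mul_assoc, inv_mul_cancel₀ hn0, one_mul]
    congr 1
    exact if_congr (by rw [Equiv.Perm.eq_inv_iff_eq]) rfl rfl
  simp only [hterm, Finset.sum_sub_distrib, Finset.sum_const, Finset.card_univ,
    Fintype.card_fin, nsmul_eq_mul, mul_inv_cancel₀ hn0]

end Specht

end SpechtCharacters

/-! ### Coordinates on multilinear polynomials: codimensions and cocharacters. -/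

section Codimensions

attribute [local instance 100] LieRing.ofAssociativeRing

namespace FreeDiff

variable {F : Type*} [Field F] {L : Type*} [LieRing L] [LieAlgebra F L] {ι : Type*}
  (b : Basis ι F (UniversalEnvelopingAlgebra F L))
  {A : Type*} [NonUnitalRing A] [Module F A] [IsScalarTower F A A] [SMulCommClass F A A]

namespace IsRightTriangular

variable {κ : A ≃ₗ[F] F × F} {ρ : L →ₗ⁅F⁆ Der F A} {e d : L}

local notation "ε" => UniversalEnvelopingAlgebra.ι F e
local notation "δ" => UniversalEnvelopingAlgebra.ι F d

/-- The kernel of the action contains the relations on ε and δ, so k acts as a combination of 1, ε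
and δ, which are all lower triangular in (α, β). -/
theorem exists_uAct (h : IsRightTriangular κ ρ e d) (k : UniversalEnvelopingAlgebra F L) :
    ∃ c₁ c₃ c₄ : F, ∀ x, κ (uAct ρ k x) = (c₁ * (κ x).1, c₃ * (κ x).1 + c₄ * (κ x).2) := by
  let J : Submodule F (UniversalEnvelopingAlgebra F L) := LinearMap.ker (uAct ρ).toLinearMap
  have hJ : ∀ k, (∀ x, κ (uAct ρ k x) = 0) → k ∈ J := fun k hk =>
    LinearMap.mem_ker.2 (LinearMap.ext fun x => κ.injective ((hk x).trans (map_zero κ).symm))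
  obtain ⟨c₁, c₂, c₃, hc⟩ := UniversalEnvelopingAlgebra.exists_sub_mem h.exists_smul (J := J)
    (fun x y hy => by
      have hy' : uAct ρ y = 0 := hy
      exact LinearMap.mem_ker.2 ((map_mul (uAct ρ) x y).trans (by rw [hy', mul_zero])))
    (fun x y hx => by
      have hx' : uAct ρ x = 0 := hx
      exact LinearMap.mem_ker.2 ((map_mul (uAct ρ) x y).trans (by rw [hx', zero_mul])))
    (hJ _ fun x => by
      rw [map_sub, LinearMap.sub_apply, uAct_mul, map_sub, h.uAct_e, h.uAct_e, sub_self])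
    (hJ _ fun x => by rw [uAct_mul, h.uAct_d, h.uAct_e]; rfl)
    (hJ _ fun x => by
      rw [map_sub, LinearMap.sub_apply, uAct_mul, map_sub, h.uAct_e, h.uAct_d, sub_self]) k
  refine ⟨c₁, c₃, c₁ + c₂, fun x => ?_⟩
  have hk : uAct ρ (k - (c₁ • 1 + c₂ • ε + c₃ • δ)) = 0 := hc
  have hx := congrArg κ (LinearMap.congr_fun hk x)
  simp only [map_sub, map_add, map_smul, LinearMap.sub_apply, LinearMap.add_apply,
    LinearMap.smul_apply, uAct_one, h.uAct_e, h.uAct_d, LinearMap.zero_apply, map_zero] at hx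
  rw [sub_eq_zero.1 hx]
  ext
  · simp
  · simp
    ring

/-- The eigenvalue of an element of `U(L)` on the first coordinate. -/
noncomputable def coeff₁ (h : IsRightTriangular κ ρ e d) (k : UniversalEnvelopingAlgebra F L) : F :=
  (h.exists_uAct k).choose

theorem uAct_fst (h : IsRightTriangular κ ρ e d) (k : UniversalEnvelopingAlgebra F L) (x : A) :
    (κ (uAct ρ k x)).1 = h.coeff₁ k * (κ x).1 := by
  obtain ⟨c₃, c₄, hc⟩ := (h.exists_uAct k).choose_spec
  exact congrArg Prod.fst (hc x)

theorem exists_uAct_snd (h : IsRightTriangular κ ρ e d) (k : UniversalEnvelopingAlgebra F L) :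
    ∃ c₃ c₄ : F, ∀ x, (κ (uAct ρ k x)).2 = c₃ * (κ x).1 + c₄ * (κ x).2 := by
  obtain ⟨c₃, c₄, hc⟩ := (h.exists_uAct k).choose_spec
  exact ⟨c₃, c₄, fun x => congrArg Prod.snd (hc x)⟩

theorem eval_word (h : IsRightTriangular κ ρ e d) (a : ℕ → A) (p : ℕ × ι) (l : List (ℕ × ι)) :
    eval b ρ a (MonoidAlgebra.single ⟨p, l⟩ 1) =
      (l.map fun q => h.coeff₁ (b q.2) * (κ (a q.1)).1).prod • uAct ρ (b p.2) (a p.1) := by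
  induction l generalizing p with
  | nil =>
    rw [List.map_nil, List.prod_nil, one_smul]
    exact lift_gen _ p
  | cons q l ih =>
    have e1 : (MonoidAlgebra.single ⟨p, q :: l⟩ 1 : FreeDiff F ι) =
        gen p * MonoidAlgebra.single ⟨q, l⟩ 1 := by
      rw [gen, MonoidAlgebra.single_mul_single, one_mul]; rfl
    have e2 : eval b ρ a (gen p) = uAct ρ (b p.2) (a p.1) := lift_gen _ p
    rw [e1, map_mul, ih, e2, h.mul_eq, map_smul, Prod.smul_fst, h.uAct_fst, List.map_cons,
      List.prod_cons, smul_eq_mul, mul_comm]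

/-- The point at which all coordinates `α` are `1` and all coordinates `β` are `0`. -/
def basePoint (κ : A ≃ₗ[F] F × F) : ℕ → A := fun _ => κ.symm (1, 0)

/-- The point at which all coordinates `α` are `1`, and the coordinates `β` are `0` except for
the `i`th one, which is `1`. -/
def unitPoint (κ : A ≃ₗ[F] F × F) (i : ℕ) : ℕ → A := fun j => κ.symm (1, if j = i then 1 else 0)

/-- The coordinates of a multilinear polynomial modulo the identities. -/
noncomputable def coords (κ : A ≃ₗ[F] F × F) (ρ : L →ₗ⁅F⁆ Der F A) (n : ℕ) :
    FreeDiff F ι →ₗ[F] F × F × (Fin n → F) :=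
  let ev (a : ℕ → A) : FreeDiff F ι →ₗ[F] F × F :=
    κ.toLinearMap ∘ₗ (eval b ρ a : FreeDiff F ι →ₗ[F] A)
  (LinearMap.fst F F F ∘ₗ ev (basePoint κ)).prod ((LinearMap.snd F F F ∘ₗ ev (basePoint κ)).prod
    (LinearMap.pi fun i => LinearMap.snd F F F ∘ₗ ev (unitPoint κ i) -
      LinearMap.snd F F F ∘ₗ ev (basePoint κ)))

theorem coords_apply (n : ℕ) (f : FreeDiff F ι) : coords b κ ρ n f =
    ((κ (eval b ρ (basePoint κ) f)).1, (κ (eval b ρ (basePoint κ) f)).2, fun i : Fin n =>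
      (κ (eval b ρ (unitPoint κ i) f)).2 - (κ (eval b ρ (basePoint κ) f)).2) := rfl

/-- Permuting variables amounts to permuting the evaluation point. The base point is constant, hence
fixed, and the i-th unit point becomes the one at σ⁻¹(i). -/
theorem coords_permFin (n : ℕ) (σ : Equiv.Perm (Fin n)) (f : FreeDiff F ι) :
    coords b κ ρ n (permFin n σ f) =
      ((coords b κ ρ n f).1, (coords b κ ρ n f).2.1,
        fun i => (coords b κ ρ n f).2.2 (σ⁻¹ i)) := by
  set τ := Equiv.Perm.viaEmbeddingHom Fin.valEmbedding σ with hτ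
  have h1 : ∀ a, eval b ρ a (permFin n σ f) = eval b ρ (a ∘ τ) f := fun a =>
    eval_permVars b ρ τ a f
  have h2 : ∀ i : Fin n, (unitPoint κ i ∘ τ : ℕ → A) = unitPoint κ ((σ⁻¹ i : Fin n) : ℕ) := by
    intro i
    have hi : τ ((σ⁻¹ i : Fin n) : ℕ) = i := by
      have := Equiv.Perm.viaEmbedding_apply σ Fin.valEmbedding (σ⁻¹ i)
      simpa [hτ, Equiv.Perm.viaEmbeddingHom_apply] using this
    funext j
    simp only [unitPoint, Function.comp_apply]
    congr 2
    refine if_congr ?_ rfl rfl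
    rw [← hi, EmbeddingLike.apply_eq_iff_eq]
  simp only [coords_apply, h1, h2]
  rfl

/-- The value of a multilinear polynomial is determined by its coordinates. -/
theorem eval_eq_of_mem_multilinear (h : IsRightTriangular κ ρ e d) {n : ℕ} (hn : 1 ≤ n)
    {f : FreeDiff F ι} (hf : f ∈ multilinear F ι n) (a : ℕ → A) :
    κ (eval b ρ a f) = ((coords b κ ρ n f).1 * ∏ j : Fin n, (κ (a j)).1,
      (coords b κ ρ n f).2.1 * ∏ j : Fin n, (κ (a j)).1 +
        ∑ i, (coords b κ ρ n f).2.2 i *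
          ∏ j : Fin n, if j = i then (κ (a j)).2 else (κ (a j)).1) := by
  obtain ⟨n, rfl⟩ : ∃ m, n = m + 1 := ⟨n - 1, by omega⟩
  induction hf using Submodule.span_induction with
  | zero => simp [Prod.mk_zero_zero]
  | add x y _ _ hx hy =>
    rw [map_add, map_add, hx, hy, map_add]
    ext
    · simp [add_mul]
    · simp [add_mul, Finset.sum_add_distrib]
      ring
  | smul c x _ hx =>
    rw [map_smul, map_smul, hx, map_smul]
    ext
    · simp [mul_assoc]
    · simp [mul_assoc, mul_add, Finset.mul_sum]
  | mem x hx =>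
    obtain ⟨σ, k, ⟨p, l⟩, hw, rfl⟩ := hx
    rw [List.ofFn_succ, List.cons.injEq] at hw
    obtain ⟨rfl, rfl⟩ := hw
    -- For a single word, only the first letter can contribute a β; every other letter contributes a
    -- scalar times its α.
    obtain ⟨c₃, c₄, hc⟩ := h.exists_uAct_snd (b (k 0))
    have hev : ∀ a : ℕ → A, κ (eval b ρ a (MonoidAlgebra.single
        ⟨((σ 0 : Fin (n + 1)), k 0), List.ofFn fun i : Fin n => ((σ i.succ : ℕ), k i.succ)⟩ 1)) =
        ((∏ i : Fin n, h.coeff₁ (b (k i.succ))) * ∏ i : Fin n, (κ (a (σ i.succ))).1) •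
          (h.coeff₁ (b (k 0)) * (κ (a (σ 0))).1, c₃ * (κ (a (σ 0))).1 + c₄ * (κ (a (σ 0))).2) := by
      intro a
      rw [h.eval_word, map_smul, List.map_ofFn, List.prod_ofFn, ← Finset.prod_mul_distrib]
      exact congrArg _ (Prod.ext (h.uAct_fst _ _) (hc _))
    have hprod : ∏ j : Fin (n + 1), (κ (a j)).1 =
        (κ (a (σ 0))).1 * ∏ i : Fin n, (κ (a (σ i.succ))).1 := by
      rw [← Equiv.prod_comp σ, Fin.prod_univ_succ]
    have hprod' : (∏ j : Fin (n + 1), if j = σ 0 then (κ (a j)).2 else (κ (a j)).1) =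
        (κ (a (σ 0))).2 * ∏ i : Fin n, (κ (a (σ i.succ))).1 := by
      rw [← Equiv.prod_comp σ, Fin.prod_univ_succ, if_pos rfl]
      congr 1
      refine Finset.prod_congr rfl fun i _ => if_neg fun hi => ?_
      exact Fin.succ_ne_zero i (σ.injective hi)
    have hr : ∀ i : Fin (n + 1), ((σ 0 : Fin (n + 1)) : ℕ) = i ↔ i = σ 0 := fun i => by
      rw [← Fin.ext_iff, eq_comm]
    simp only [coords_apply, hev]
    simp only [basePoint, unitPoint, LinearEquiv.apply_symm_apply, Prod.smul_fst, Prod.smul_snd,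
      smul_eq_mul, Finset.prod_const_one, mul_one, mul_zero, add_zero, hr, mul_add,
      add_sub_cancel_left, mul_ite, ite_mul, zero_mul, Finset.sum_ite_eq', Finset.mem_univ,
      if_true, hprod, hprod']
    ext
    · simp
      ring
    · simp
      ring

theorem multilinearId_eq_ker (h : IsRightTriangular κ ρ e d) {n : ℕ} (hn : 1 ≤ n) :
    multilinearId b ρ n = LinearMap.ker (coords b κ ρ n ∘ₗ (multilinear F ι n).subtype) := by
  ext ⟨f, hf⟩
  rw [LinearMap.mem_ker]
  change (∀ a, eval b ρ a f = 0) ↔ coords b κ ρ n f = 0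
  constructor
  · intro h0
    simp only [coords_apply, h0, map_zero, Prod.fst_zero, Prod.snd_zero, sub_zero]
    rfl
  · intro h0 a
    apply κ.injective
    rw [h.eval_eq_of_mem_multilinear b hn hf, h0, map_zero]
    ext <;> simp

/-- Words headed by x_i^k with the other variables as a tail realise the unit vectors when k is 1 -
ε, δ or ε. -/
theorem range_coords (h : IsRightTriangular κ ρ e d) {n : ℕ} (hn : 1 ≤ n) :
    LinearMap.range (coords b κ ρ n ∘ₗ (multilinear F ι n).subtype) = ⊤ := by
  obtain ⟨n, rfl⟩ : ∃ m, n = m + 1 := ⟨n - 1, by omega⟩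
  set R := LinearMap.range (coords b κ ρ (n + 1) ∘ₗ (multilinear F ι (n + 1)).subtype) with hR
  -- The basis of U(L) is arbitrary and need not contain 1, so the tail letters carry some basis
  -- element acting nontrivially on α. One exists, for otherwise 1 would act by zero on α.
  obtain ⟨i₀, hi₀⟩ : ∃ i₀, h.coeff₁ (b i₀) ≠ 0 := by
    by_contra! hc
    have : LinearMap.fst F F F ∘ₗ κ.toLinearMap ∘ₗ LinearMap.applyₗ (κ.symm (1, 0)) ∘ₗ
        (uAct ρ).toLinearMap = 0 := b.ext fun i => by
      change (κ (uAct ρ (b i) (κ.symm (1, 0)))).1 = 0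
      rw [h.uAct_fst, hc, zero_mul]
    have h1 : (κ (uAct ρ 1 (κ.symm (1, 0)))).1 = 0 := LinearMap.congr_fun this 1
    rw [uAct_one] at h1
    simp at h1
  have key : ∀ (i : Fin (n + 1)) (k : UniversalEnvelopingAlgebra F L),
      ((κ (uAct ρ k (κ.symm (1, 0)))).1, (κ (uAct ρ k (κ.symm (1, 0)))).2,
        fun j : Fin (n + 1) => (κ (uAct ρ k (unitPoint κ j i))).2 -
          (κ (uAct ρ k (κ.symm (1, 0)))).2) ∈ R := by
    intro i k
    let ev (x : A) : UniversalEnvelopingAlgebra F L →ₗ[F] F × F :=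
      κ.toLinearMap ∘ₗ LinearMap.applyₗ x ∘ₗ (uAct ρ).toLinearMap
    let G : UniversalEnvelopingAlgebra F L →ₗ[F] F × F × (Fin (n + 1) → F) :=
      (LinearMap.fst F F F ∘ₗ ev (κ.symm (1, 0))).prod
        ((LinearMap.snd F F F ∘ₗ ev (κ.symm (1, 0))).prod
        (LinearMap.pi fun j : Fin (n + 1) => LinearMap.snd F F F ∘ₗ ev (unitPoint κ j i) -
          LinearMap.snd F F F ∘ₗ ev (κ.symm (1, 0))))
    -- The target vector is linear in k, so it suffices to treat basis elements, for which it is an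
    -- actual word up to the nonzero scalar contributed by the tail.
    suffices hG : (⊤ : Submodule F _) ≤ R.comap G from hG (Submodule.mem_top (x := k))
    rw [← b.span_eq, Submodule.span_le]
    rintro _ ⟨i', rfl⟩
    have hc : h.coeff₁ (b i₀) ^ n ≠ 0 := pow_ne_zero _ hi₀
    rw [SetLike.mem_coe, Submodule.mem_comap, ← Submodule.smul_mem_iff R hc]
    set w : FreeSemigroup (ℕ × ι) :=
      ⟨((i : ℕ), i'), List.ofFn fun j : Fin n => ((Equiv.swap 0 i j.succ : ℕ), i₀)⟩ with hw
    refine ⟨⟨MonoidAlgebra.single w 1, Submodule.subset_span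
      ⟨Equiv.swap 0 i, Fin.cons i' fun _ => i₀, w, ?_, rfl⟩⟩, ?_⟩
    · rw [List.ofFn_succ, hw]
      simp
    · have hev : ∀ a : ℕ → A, (∀ j, (κ (a j)).1 = 1) →
          eval b ρ a (MonoidAlgebra.single w 1) =
            h.coeff₁ (b i₀) ^ n • uAct ρ (b i') (a i) := by
        intro a ha
        rw [hw, h.eval_word, List.map_ofFn, List.prod_ofFn]
        simp [ha]
      have hu : ∀ i j, (κ (unitPoint κ i j)).1 = 1 := fun i j => by simp [unitPoint]
      change coords b κ ρ (n + 1) (MonoidAlgebra.single w 1) = _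
      rw [coords_apply]
      simp only [hev (basePoint κ) (fun j => by simp [basePoint]),
        hev (unitPoint κ _) (hu _), map_smul]
      ext
      · rfl
      · rfl
      · exact (mul_sub _ _ _).symm
  have h1 : ((1 : F), (0 : F), (0 : Fin (n + 1) → F)) ∈ R := by
    convert key 0 (1 - ε) using 1
    simp only [h.uAct_one_sub_e, LinearEquiv.apply_symm_apply, sub_zero]
    rfl
  have h2 : ((0 : F), (1 : F), (0 : Fin (n + 1) → F)) ∈ R := by
    convert key 0 δ using 1
    simp only [h.uAct_d, LinearEquiv.apply_symm_apply, unitPoint, sub_self]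
    rfl
  have h3 : ∀ i, ((0 : F), (0 : F), (Pi.single i 1 : Fin (n + 1) → F)) ∈ R := by
    intro i
    convert key i ε using 1
    simp only [h.uAct_e, LinearEquiv.apply_symm_apply, unitPoint, sub_zero]
    congr 2
    funext j
    simp only [Pi.single_apply, Fin.ext_iff, eq_comm]
  refine eq_top_iff.2 ?_
  rintro ⟨p, q, r⟩ -
  have := R.add_mem (R.add_mem (R.smul_mem p h1) (R.smul_mem q h2))
    (R.sum_mem fun i (_ : i ∈ Finset.univ) => R.smul_mem (r i) (h3 i))
  convert this using 1
  ext j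
  · simp [Prod.fst_sum]
  · simp [Prod.fst_sum, Prod.snd_sum]
  · simp [Prod.snd_sum, Finset.sum_apply, Pi.single_apply]

/-- The multilinear polynomials modulo the identities, in coordinates. -/
noncomputable def quotEquiv (h : IsRightTriangular κ ρ e d) {n : ℕ} (hn : 1 ≤ n) :
    (multilinear F ι n ⧸ multilinearId b ρ n) ≃ₗ[F] F × F × (Fin n → F) :=
  (Submodule.quotEquivOfEq _ _ (h.multilinearId_eq_ker b hn)).trans
    (LinearMap.quotKerEquivOfSurjective _ (LinearMap.range_eq_top.1 (h.range_coords b hn)))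

theorem codim_eq (h : IsRightTriangular κ ρ e d) {n : ℕ} (hn : 1 ≤ n) : codim b ρ n = n + 2 := by
  rw [codim, (h.quotEquiv b hn).finrank_eq]
  simp
  ring

/-- In coordinates, S_n acts trivially on the two copies of F and by permutation on Fⁿ. -/
theorem cochar_eq (h : IsRightTriangular κ ρ e d) {n : ℕ} (hn : 1 ≤ n)
    (σ : Equiv.Perm (Fin n)) :
    cochar b ρ n σ = 2 + ∑ k, if σ k = k then 1 else 0 := by
  have hconj : (h.quotEquiv b hn).conj (quotRep b ρ n σ) =
      LinearMap.prodMap LinearMap.id (LinearMap.prodMap LinearMap.id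
        (LinearMap.funLeft F F (σ⁻¹ : Equiv.Perm (Fin n)))) := by
    refine LinearMap.ext fun x => ?_
    obtain ⟨y, rfl⟩ := (h.quotEquiv b hn).surjective x
    obtain ⟨⟨f, hf⟩, rfl⟩ := Submodule.Quotient.mk_surjective _ y
    rw [LinearEquiv.conj_apply_apply, LinearEquiv.symm_apply_apply]
    exact coords_permFin b n σ f
  rw [cochar, Representation.character, ← LinearMap.trace_conj' _ (h.quotEquiv b hn), hconj,
    LinearMap.trace_prodMap', LinearMap.trace_prodMap', LinearMap.trace_id,
    LinearMap.trace_pi_eq_sum]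
  have : ∀ k, LinearMap.funLeft F F (σ⁻¹ : Equiv.Perm (Fin n)) (Pi.single k 1) k =
      if σ k = k then 1 else 0 := fun k => by
    rw [LinearMap.funLeft_apply, Pi.single_apply]
    exact if_congr (by rw [Equiv.Perm.inv_eq_iff_eq, eq_comm]) rfl rfl
  simp only [this, finrank_self]
  push_cast
  ring

end IsRightTriangular

end FreeDiff

end Codimensions

/-! ### Reversal of words and the opposite algebra. -/

section Reversal

attribute [local instance 100] LieRing.ofAssociativeRing

open MulOpposite

namespace FreeDiff

variable {F : Type*} [Field F] {L : Type*} [LieRing L] [LieAlgebra F L] {ι : Type*}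

theorem induction_on {P : FreeDiff F ι → Prop} (f : FreeDiff F ι) (hgen : ∀ p, P (gen p))
    (hadd : ∀ f g, P f → P g → P (f + g)) (hsmul : ∀ (c : F) f, P f → P (c • f))
    (hmul : ∀ f g, P f → P g → P (f * g)) (hzero : P 0) : P f := by
  induction f using MonoidAlgebra.induction_linear with
  | zero => exact hzero
  | add f g hf hg => exact hadd f g hf hg
  | single w c =>
    have e1 : (MonoidAlgebra.single w c : FreeDiff F ι) = c • MonoidAlgebra.single w 1 := by
      simp
    rw [e1]
    refine hsmul c _ ?_
    induction w using FreeSemigroup.recOnMul with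
    | ih1 p => exact hgen p
    | ih2 p w hp hw =>
      have e2 : (MonoidAlgebra.single (FreeSemigroup.of p * w) 1 : FreeDiff F ι) =
          gen p * MonoidAlgebra.single w 1 := by
        rw [gen, MonoidAlgebra.single_mul_single, one_mul]
      rw [e2]
      exact hmul _ _ (hgen p) (hw (by simp))

/-- The anti-automorphism of the free algebra reversing the words. -/
noncomputable def rev : FreeDiff F ι →ₗ[F] FreeDiff F ι :=
  (opLinearEquiv F).symm.toLinearMap ∘ₗ
    ((lift fun p => op (gen p) : FreeDiff F ι →ₙₐ[F] (FreeDiff F ι)ᵐᵒᵖ) :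
      FreeDiff F ι →ₗ[F] (FreeDiff F ι)ᵐᵒᵖ)

theorem rev_eq (f : FreeDiff F ι) : rev f =
    unop ((lift fun p => op (gen p) : FreeDiff F ι →ₙₐ[F] (FreeDiff F ι)ᵐᵒᵖ) f) := rfl

@[simp] theorem rev_gen (p : ℕ × ι) : rev (gen p : FreeDiff F ι) = gen p := by
  rw [rev_eq, lift_gen, unop_op]

theorem rev_mul (f g : FreeDiff F ι) : rev (f * g) = rev g * rev f := by
  rw [rev_eq, map_mul, unop_mul]
  rfl

@[simp] theorem rev_rev (f : FreeDiff F ι) : rev (rev f) = f := by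
  induction f using induction_on with
  | hgen p => simp
  | hadd f g hf hg => rw [map_add, map_add, hf, hg]
  | hsmul c f hf => rw [map_smul, map_smul, hf]
  | hmul f g hf hg => rw [rev_mul, rev_mul, hf, hg]
  | hzero => simp

theorem rev_single (l : List (ℕ × ι)) (p : ℕ × ι) : ∃ w : FreeSemigroup (ℕ × ι),
    w.head :: w.tail = (p :: l).reverse ∧
      rev (MonoidAlgebra.single ⟨p, l⟩ 1 : FreeDiff F ι) = MonoidAlgebra.single w 1 := by
  induction l generalizing p with
  | nil => exact ⟨⟨p, []⟩, rfl, rev_gen p⟩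
  | cons q l ih =>
    obtain ⟨w, hw, hr⟩ := ih q
    refine ⟨w * FreeSemigroup.of p, ?_, ?_⟩
    · rw [List.reverse_cons, ← hw]
      rfl
    · have e1 : (MonoidAlgebra.single ⟨p, q :: l⟩ 1 : FreeDiff F ι) =
          gen p * MonoidAlgebra.single ⟨q, l⟩ 1 := by
        rw [gen, MonoidAlgebra.single_mul_single, one_mul]; rfl
      rw [e1, rev_mul, hr, rev_gen, gen, MonoidAlgebra.single_mul_single, one_mul]

theorem rev_mem_multilinear {n : ℕ} {f : FreeDiff F ι} (hf : f ∈ multilinear F ι n) :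
    rev f ∈ multilinear F ι n := by
  suffices h : multilinear F ι n ≤ (multilinear F ι n).comap rev from h hf
  refine Submodule.span_le.2 ?_
  rintro _ ⟨σ, h, ⟨p, l⟩, hw, rfl⟩
  obtain ⟨w, hw', hr⟩ := rev_single (F := F) l p
  rw [SetLike.mem_coe, Submodule.mem_comap, hr]
  refine Submodule.subset_span ⟨σ * Fin.revPerm, h ∘ Fin.rev, w, ?_, rfl⟩
  dsimp only at hw
  rw [hw', hw]
  refine List.ext_getElem (by simp) fun i h1 h2 => ?_
  rw [List.getElem_reverse, List.getElem_ofFn, List.getElem_ofFn]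
  have hi : i < n := by simpa using h2
  have : (⟨(List.ofFn fun k => ((σ k : ℕ), h k)).length - 1 - i, by simp; omega⟩ : Fin n) =
      Fin.rev ⟨i, hi⟩ := by
    ext
    simp [Fin.val_rev]
    omega
  simp only [this]
  rfl

theorem rev_permVars (σ : Equiv.Perm ℕ) (f : FreeDiff F ι) :
    rev (permVars σ f) = permVars σ (rev f) := by
  have hmul : ∀ f g : FreeDiff F ι, permVars σ (f * g) = permVars σ f * permVars σ g :=
    fun f g => map_mul (lift fun p => gen (σ p.1, p.2) : FreeDiff F ι →ₙₐ[F] FreeDiff F ι) f g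
  induction f using induction_on with
  | hgen p => rw [permVars_gen, rev_gen, rev_gen, permVars_gen]
  | hadd f g hf hg => simp only [map_add, hf, hg]
  | hsmul c f hf => simp only [map_smul, hf]
  | hmul f g hf hg => simp only [hmul, rev_mul, hf, hg]
  | hzero => simp

variable (b : Basis ι F (UniversalEnvelopingAlgebra F L))

@[simp] theorem rev_X (j : ℕ) (h : UniversalEnvelopingAlgebra F L) :
    rev (X b j h) = X b j h := by
  have : rev ∘ₗ X b j = X b j := b.ext fun i => by simp
  exact LinearMap.congr_fun this h

theorem rev_uAct (h : UniversalEnvelopingAlgebra F L) (f : FreeDiff F ι) :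
    rev (uAct (act b) h f) = uAct (act b) h (rev f) := by
  induction h using UniversalEnvelopingAlgebra.induction_on generalizing f with
  | hι γ =>
    induction f using induction_on with
    | hgen p => rw [← X_basis b, uAct_act_X, rev_X, rev_X, uAct_act_X]
    | hadd f g hf hg => simp only [map_add, hf, hg]
    | hsmul c f hf => simp only [map_smul, hf]
    | hmul f g hf hg => rw [uAct_ι_mul, map_add, rev_mul, rev_mul, rev_mul, uAct_ι_mul, hf, hg,
        add_comm]
    | hzero => simp
  | hc c => simp only [AlgHom.commutes, Module.algebraMap_end_apply, map_smul]
  | ha x y hx hy => simp only [map_add, LinearMap.add_apply, hx, hy]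
  | hm x y hx hy => simp only [uAct_mul, hx, hy]

theorem IsTLIdeal.comap_rev {I : Submodule F (FreeDiff F ι)} (hI : IsTLIdeal b I) :
    IsTLIdeal b (I.comap rev) where
  mul_mem_left f g hg := by
    rw [Submodule.mem_comap, rev_mul]
    exact hI.mul_mem_right _ _ hg
  mul_mem_right f g hf := by
    rw [Submodule.mem_comap, rev_mul]
    exact hI.mul_mem_left _ _ hf
  act_mem h f hf := by
    rw [Submodule.mem_comap, rev_uAct]
    exact hI.act_mem h _ hf
  map_mem ψ hψ f hf := by
    -- Conjugation by the anti-automorphism makes ψ a homomorphism again, and it still commutes with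
    -- U(L) because reversal does.
    let ψ' : FreeDiff F ι →ₙₐ[F] FreeDiff F ι :=
      { toFun := fun g => rev (ψ (rev g))
        map_smul' := fun c g => by simp
        map_zero' := by simp
        map_add' := fun g k => by simp
        map_mul' := fun g k => by rw [rev_mul, map_mul, rev_mul] }
    have := hI.map_mem ψ' (fun h g => by
      change rev (ψ (rev (uAct (act b) h g))) = uAct (act b) h (rev (ψ (rev g)))
      rw [rev_uAct, hψ, rev_uAct]) (rev f) hf
    change rev (ψ (rev (rev f))) ∈ I at this
    rwa [rev_rev] at this

variable {A : Type*} [NonUnitalRing A] [Module F A] [IsScalarTower F A A] [SMulCommClass F A A]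
  (ρ : L →ₗ⁅F⁆ Der F A)

/-- The action of `L` on the opposite algebra. -/
def opAct : L →ₗ⁅F⁆ Der F Aᵐᵒᵖ where
  toFun γ := ⟨(opLinearEquiv F).toLinearMap ∘ₗ (ρ γ : Module.End F A) ∘ₗ
    (opLinearEquiv F).symm.toLinearMap, fun x y => by
      refine unop_injective ?_
      change (ρ γ : Module.End F A) (unop y * unop x) =
        unop y * (ρ γ : Module.End F A) (unop x) + (ρ γ : Module.End F A) (unop y) * unop x
      rw [(ρ γ).2, add_comm]⟩
  map_add' γ γ' := by
    apply Subtype.ext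
    ext x
    simp
  map_smul' c γ := by
    apply Subtype.ext
    ext x
    simp
  map_lie' := by
    intro γ γ'
    apply Subtype.ext
    ext x
    simp [Ring.lie_def]

theorem opAct_apply (γ : L) (x : Aᵐᵒᵖ) :
    (opAct ρ γ : Module.End F Aᵐᵒᵖ) x = op ((ρ γ : Module.End F A) (unop x)) := rfl

theorem uAct_opAct (h : UniversalEnvelopingAlgebra F L) (x : A) :
    uAct (opAct ρ) h (op x) = op (uAct ρ h x) := by
  induction h using UniversalEnvelopingAlgebra.induction_on generalizing x with
  | hι γ => rw [uAct_ι, uAct_ι, opAct_apply, unop_op]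
  | hc c => simp only [AlgHom.commutes, Module.algebraMap_end_apply, op_smul]
  | ha y z hy hz => rw [map_add, map_add, LinearMap.add_apply, LinearMap.add_apply, hy, hz, op_add]
  | hm y z hy hz => rw [uAct_mul, uAct_mul, hz, hy]

theorem eval_rev (a : ℕ → A) (f : FreeDiff F ι) :
    eval b (opAct ρ) (fun j => op (a j)) (rev f) = op (eval b ρ a f) := by
  induction f using induction_on with
  | hgen p => rw [← X_basis b, rev_X, eval_X, eval_X, uAct_opAct]
  | hadd f g hf hg => rw [map_add, map_add, map_add, hf, hg, op_add]
  | hsmul c f hf => rw [map_smul, map_smul, map_smul, hf, op_smul]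
  | hmul f g hf hg => rw [rev_mul, map_mul, map_mul, hf, hg, op_mul]
  | hzero => simp

theorem rev_mem_idL_opAct {f : FreeDiff F ι} :
    rev f ∈ idL b (opAct ρ) ↔ f ∈ idL b ρ := by
  constructor
  · intro h a
    exact op_injective ((eval_rev b ρ a f).symm.trans (h _))
  · intro h a
    have : eval b (opAct ρ) a (rev f) = op (eval b ρ (fun j => unop (a j)) f) :=
      eval_rev b ρ (fun j => unop (a j)) f
    rw [this, h, op_zero]

/-- The reversal of words on the multilinear polynomials. -/
noncomputable def revMultilinear (n : ℕ) : multilinear F ι n ≃ₗ[F] multilinear F ι n :=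
  LinearEquiv.ofInvolutive (rev.restrict fun _ => rev_mem_multilinear)
    fun f => Subtype.ext (rev_rev f.1)

/-- The reversal of words on the multilinear polynomials modulo identities. -/
noncomputable def revQuot (n : ℕ) : (multilinear F ι n ⧸ multilinearId b ρ n) ≃ₗ[F]
    multilinear F ι n ⧸ multilinearId b (opAct ρ) n :=
  Submodule.Quotient.equiv _ _ (revMultilinear n) (by
    ext f
    obtain ⟨g, rfl⟩ := (revMultilinear n).surjective f
    rw [Submodule.mem_map_equiv, LinearEquiv.symm_apply_apply]
    exact (rev_mem_idL_opAct b ρ).symm)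

theorem codim_opAct (n : ℕ) : codim b (opAct ρ) n = codim b ρ n :=
  (revQuot b ρ n).finrank_eq.symm

/-- Reversal permutes positions while S_n permutes variables, so the two commute and the quotients
are isomorphic as S_n-modules. -/
theorem cochar_opAct (n : ℕ) : cochar b (opAct ρ) n = cochar b ρ n := by
  funext σ
  rw [cochar, cochar, Representation.character, Representation.character,
    ← LinearMap.trace_conj' (quotRep b ρ n σ) (revQuot b ρ n)]
  congr 1
  refine LinearMap.ext fun x => ?_
  obtain ⟨y, rfl⟩ := (revQuot b ρ n).surjective x
  obtain ⟨f, rfl⟩ := Submodule.Quotient.mk_surjective _ y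
  rw [LinearEquiv.conj_apply_apply, LinearEquiv.symm_apply_apply]
  exact congrArg (Submodule.Quotient.mk (p := multilinearId b (opAct ρ) n))
    (Subtype.ext (rev_permVars _ f.1).symm)

end FreeDiff

end Reversal

/-! ### The derivations of the two algebras, and the transfer of the general results. -/

section Derivations

attribute [local instance 100] LieRing.ofAssociativeRing

/-- A Lie algebra spanned by `x`, `y` with `[x, y] = y` is metabelian. -/
theorem LieAlgebra.derivedSeries_two_eq_bot {F D : Type*} [Field F] [LieRing D] [LieAlgebra F D]
    {x y : D} (hs : ∀ d : D, ∃ s t : F, d = s • x + t • y) (hxy : ⁅x, y⁆ = y) :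
    LieAlgebra.derivedSeries F D 2 = ⊥ := by
  have h1 : ∀ d ∈ (⁅(⊤ : LieIdeal F D), (⊤ : LieIdeal F D)⁆ : LieIdeal F D),
      ∃ c : F, c • y = d := by
    intro d hd
    rw [← Submodule.mem_span_singleton]
    rw [← LieSubmodule.mem_toSubmodule, LieSubmodule.lieIdeal_oper_eq_linear_span'] at hd
    refine Submodule.span_le.2 ?_ hd
    rintro _ ⟨u, -, v, -, rfl⟩
    obtain ⟨s, t, rfl⟩ := hs u
    obtain ⟨s', t', rfl⟩ := hs v
    refine Submodule.mem_span_singleton.2 ⟨s * t' - t * s', ?_⟩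
    have hyx : ⁅y, x⁆ = -y := by rw [← lie_skew, hxy]
    simp only [add_lie, lie_add, smul_lie, lie_smul, lie_self, hxy, hyx]
    module
  rw [LieAlgebra.derivedSeries_def, LieAlgebra.derivedSeriesOfIdeal_succ,
    LieAlgebra.derivedSeriesOfIdeal_succ, LieAlgebra.derivedSeriesOfIdeal_zero,
    LieSubmodule.lie_eq_bot_iff]
  intro u hu v hv
  obtain ⟨c, rfl⟩ := h1 u hu
  obtain ⟨c', rfl⟩ := h1 v hv
  simp

/-- The structure of a Lie algebra spanned by independent `x`, `y` with `[x, y] = y`. -/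
theorem LieAlgebra.finrank_eq_two_and_metabelian {F D : Type*} [Field F] [LieRing D]
    [LieAlgebra F D] {x y : D} (hs : ∀ d : D, ∃ s t : F, d = s • x + t • y)
    (hi : ∀ s t : F, s • x + t • y = 0 → s = 0 ∧ t = 0) (hxy : ⁅x, y⁆ = y) :
    finrank F D = 2 ∧ LieAlgebra.derivedSeries F D 2 = ⊥ ∧ Submodule.span F {x, y} = ⊤ ∧
      ⁅x, y⁆ = y := by
  have hspan : Submodule.span F {x, y} = ⊤ := eq_top_iff.2 fun d _ => by
    obtain ⟨s, t, h⟩ := hs d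
    exact Submodule.mem_span_pair.2 ⟨s, t, h.symm⟩
  have hli : LinearIndependent F ![x, y] := LinearIndependent.pair_iff.2 hi
  refine ⟨?_, LieAlgebra.derivedSeries_two_eq_bot hs hxy, hspan, hxy⟩
  have := finrank_span_eq_card hli
  rwa [Matrix.range_cons, Matrix.range_cons, Matrix.range_empty, Set.union_empty,
    Set.singleton_union, hspan, finrank_top, Fintype.card_fin] at this

open Matrix

variable (F : Type*) [Field F]

/-- The coordinates of `M₁`. -/
noncomputable def coordsM₁ : M₁ F ≃ₗ[F] F × F where
  toFun x := (x.1 1 1, x.1 0 1)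
  map_add' x y := rfl
  map_smul' c x := rfl
  invFun p := ⟨p.1 • single 1 1 1 + p.2 • single 0 1 1, mem_M₁.2 ⟨p.1, p.2, rfl⟩⟩
  left_inv := by
    rintro ⟨x, hx⟩
    obtain ⟨a, c, rfl⟩ := mem_M₁.1 hx
    apply Subtype.ext
    simp
  right_inv p := by simp

/-- The coordinates of `M₂`. -/
noncomputable def coordsM₂ : M₂ F ≃ₗ[F] F × F where
  toFun x := (x.1 0 0, x.1 0 1)
  map_add' x y := rfl
  map_smul' c x := rfl
  invFun p := ⟨p.1 • single 0 0 1 + p.2 • single 0 1 1, mem_M₂.2 ⟨p.1, p.2, rfl⟩⟩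
  left_inv := by
    rintro ⟨x, hx⟩
    obtain ⟨a, c, rfl⟩ := mem_M₂.1 hx
    apply Subtype.ext
    simp
  right_inv p := by simp

variable {F}

theorem coordsM₁_apply (x : M₁ F) : coordsM₁ F x = (x.1 1 1, x.1 0 1) := rfl

theorem coordsM₂_apply (x : M₂ F) : coordsM₂ F x = (x.1 0 0, x.1 0 1) := rfl

theorem M₁_mul_eq (x y : M₁ F) : x * y = (coordsM₁ F y).1 • x := by
  obtain ⟨x, hx⟩ := x
  obtain ⟨y, hy⟩ := y
  obtain ⟨a, c, rfl⟩ := mem_M₁.1 hx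
  obtain ⟨a', c', rfl⟩ := mem_M₁.1 hy
  apply Subtype.ext
  ext i j
  fin_cases i <;> fin_cases j <;> simp [coordsM₁_apply, Matrix.mul_apply, Matrix.single, mul_comm]

theorem M₂_mul_eq (x y : M₂ F) : x * y = (coordsM₂ F x).1 • y := by
  obtain ⟨x, hx⟩ := x
  obtain ⟨y, hy⟩ := y
  obtain ⟨a, c, rfl⟩ := mem_M₂.1 hx
  obtain ⟨a', c', rfl⟩ := mem_M₂.1 hy
  apply Subtype.ext
  ext i j
  fin_cases i <;> fin_cases j <;> simp [coordsM₂_apply, Matrix.mul_apply, Matrix.single]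

theorem coordsM₁_ε₁ (x : M₁ F) :
    coordsM₁ F ((ε₁ F : Module.End F (M₁ F)) x) = (0, (coordsM₁ F x).2) := by
  simp [coordsM₁_apply, ε₁]

theorem coordsM₁_δ₁ (x : M₁ F) :
    coordsM₁ F ((δ₁ F : Module.End F (M₁ F)) x) = (0, (coordsM₁ F x).1) := by
  simp [coordsM₁_apply, δ₁]

theorem coordsM₂_ε₂ (x : M₂ F) :
    coordsM₂ F ((ε₂ F : Module.End F (M₂ F)) x) = (0, (coordsM₂ F x).2) := by
  simp [coordsM₂_apply, ε₂]

theorem coordsM₂_δ₂ (x : M₂ F) :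
    coordsM₂ F ((δ₂ F : Module.End F (M₂ F)) x) = (0, (coordsM₂ F x).1) := by
  simp [coordsM₂_apply, δ₂]

section Coordinates

variable {A : Type*} [NonUnitalRing A] [Module F A] [IsScalarTower F A A] [SMulCommClass F A A]
  {κ : A ≃ₗ[F] F × F} {e d : Der F A}

/-- The derivations of an algebra in which one of the factors acts on products by scalars. -/
theorem Der.exists_eq_smul_add_smul
    (hmul : (∀ x y, x * y = (κ y).1 • x) ∨ ∀ x y, x * y = (κ x).1 • y)
    (he : ∀ x, κ ((e : Module.End F A) x) = (0, (κ x).2))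
    (hd : ∀ x, κ ((d : Module.End F A) x) = (0, (κ x).1)) (D : Der F A) :
    ∃ s t : F, D = s • e + t • d := by
  -- When the right factor acts by scalars, comparing D(yx) = α(x)D(y) with the Leibniz rule leaves
  -- α(Dx)y = 0 for a nonzero y. The other case is the mirror image.
  have hfst : ∀ x, (κ ((D : Module.End F A) x)).1 = 0 := by
    intro x
    have hne : ∃ y : A, y ≠ 0 := ⟨κ.symm (1, 0), by simp⟩
    obtain ⟨y, hy⟩ := hne
    rcases hmul with hmul | hmul
    · have h := D.2 y x
      rw [hmul, hmul, hmul, map_smul] at h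
      exact (smul_eq_zero.1 (left_eq_add.1 h)).resolve_right hy
    · have h := D.2 x y
      rw [hmul, hmul, hmul, map_smul] at h
      exact (smul_eq_zero.1 (right_eq_add.1 h)).resolve_right hy
  refine ⟨(κ ((D : Module.End F A) (κ.symm (0, 1)))).2,
    (κ ((D : Module.End F A) (κ.symm (1, 0)))).2, ?_⟩
  apply Subtype.ext
  refine LinearMap.ext fun x => κ.injective ?_
  obtain ⟨⟨p, q⟩, rfl⟩ := κ.symm.surjective x
  have hpq : κ.symm (p, q) = p • κ.symm (1, 0) + q • κ.symm (0, 1) := by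
    rw [← map_smul, ← map_smul, ← map_add]
    simp
  refine Prod.ext ?_ ?_
  · rw [hfst]
    simp [he, hd]
  · set s := (κ ((D : Module.End F A) (κ.symm (0, 1)))).2 with hs
    set t := (κ ((D : Module.End F A) (κ.symm (1, 0)))).2 with ht
    change _ = (κ (s • (e : Module.End F A) (κ.symm (p, q)) +
      t • (d : Module.End F A) (κ.symm (p, q)))).2
    rw [map_add, map_smul, map_smul, he, hd]
    conv_lhs => rw [hpq, map_add, map_smul, map_smul, map_add, map_smul, map_smul]
    simp only [Prod.snd_add, Prod.smul_snd, smul_eq_mul, LinearEquiv.apply_symm_apply]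
    ring

theorem Der.smul_add_smul_eq_zero
    (he : ∀ x, κ ((e : Module.End F A) x) = (0, (κ x).2))
    (hd : ∀ x, κ ((d : Module.End F A) x) = (0, (κ x).1)) (s t : F)
    (h : s • e + t • d = 0) : s = 0 ∧ t = 0 := by
  have key : ∀ x, s * (κ x).2 + t * (κ x).1 = 0 := by
    intro x
    have h1 : s • (e : Module.End F A) x + t • (d : Module.End F A) x = 0 :=
      LinearMap.congr_fun (congrArg Subtype.val h) x
    have h2 := congrArg (fun z => (κ z).2) h1
    simpa only [map_add, map_smul, he, hd, Prod.snd_add, Prod.smul_snd, smul_eq_mul, map_zero,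
      Prod.snd_zero] using h2
  exact ⟨by simpa using key (κ.symm (0, 1)), by simpa using key (κ.symm (1, 0))⟩

theorem Der.lie_eq
    (he : ∀ x, κ ((e : Module.End F A) x) = (0, (κ x).2))
    (hd : ∀ x, κ ((d : Module.End F A) x) = (0, (κ x).1)) : ⁅e, d⁆ = d := by
  apply Subtype.ext
  refine LinearMap.ext fun x => κ.injective ?_
  rw [LieSubalgebra.coe_bracket, Ring.lie_def, LinearMap.sub_apply, Module.End.mul_apply,
    Module.End.mul_apply, map_sub, he, hd, hd, he]
  simp

/-- The structure of the Lie algebra of derivations. -/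
theorem Der.structure
    (hmul : (∀ x y, x * y = (κ y).1 • x) ∨ ∀ x y, x * y = (κ x).1 • y)
    (he : ∀ x, κ ((e : Module.End F A) x) = (0, (κ x).2))
    (hd : ∀ x, κ ((d : Module.End F A) x) = (0, (κ x).1)) :
    finrank F (Der F A) = 2 ∧ LieAlgebra.derivedSeries F (Der F A) 2 = ⊥ ∧
      Submodule.span F {e, d} = ⊤ ∧ ⁅e, d⁆ = d :=
  LieAlgebra.finrank_eq_two_and_metabelian (Der.exists_eq_smul_add_smul hmul he hd)
    (Der.smul_add_smul_eq_zero he hd) (Der.lie_eq he hd)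

end Coordinates

variable {L : Type*} [LieRing L] [LieAlgebra F L]

namespace FreeDiff

theorem isRightTriangular_M₁ (φ : L ≃ₗ⁅F⁆ Der F (M₁ F)) :
    IsRightTriangular (coordsM₁ F) (φ : L →ₗ⁅F⁆ Der F (M₁ F)) (φ.symm (ε₁ F)) (φ.symm (δ₁ F)) where
  mul_eq := M₁_mul_eq
  exists_smul γ := by
    obtain ⟨s, t, h⟩ :=
      Der.exists_eq_smul_add_smul (κ := coordsM₁ F) (e := ε₁ F) (d := δ₁ F)
        (Or.inl M₁_mul_eq) coordsM₁_ε₁ coordsM₁_δ₁ (φ γ)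
    refine ⟨s, t, ?_⟩
    rw [← map_smul, ← map_smul, ← map_add, ← h]
    exact (φ.symm_apply_apply γ).symm
  act_e x := by
    have : (φ : L →ₗ⁅F⁆ Der F (M₁ F)) (φ.symm (ε₁ F)) = ε₁ F := φ.apply_symm_apply _
    rw [this]
    exact coordsM₁_ε₁ x
  act_d x := by
    have : (φ : L →ₗ⁅F⁆ Der F (M₁ F)) (φ.symm (δ₁ F)) = δ₁ F := φ.apply_symm_apply _
    rw [this]
    exact coordsM₁_δ₁ x

theorem isRightTriangular_M₂ (φ : L ≃ₗ⁅F⁆ Der F (M₂ F)) :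
    IsRightTriangular ((MulOpposite.opLinearEquiv F).symm.trans (coordsM₂ F))
      (opAct (φ : L →ₗ⁅F⁆ Der F (M₂ F))) (φ.symm (ε₂ F)) (φ.symm (δ₂ F)) where
  mul_eq x y := MulOpposite.unop_injective (M₂_mul_eq y.unop x.unop)
  exists_smul γ := by
    obtain ⟨s, t, h⟩ :=
      Der.exists_eq_smul_add_smul (κ := coordsM₂ F) (e := ε₂ F) (d := δ₂ F)
        (Or.inr M₂_mul_eq) coordsM₂_ε₂ coordsM₂_δ₂ (φ γ)
    refine ⟨s, t, ?_⟩
    rw [← map_smul, ← map_smul, ← map_add, ← h]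
    exact (φ.symm_apply_apply γ).symm
  act_e x := by
    have : (φ : L →ₗ⁅F⁆ Der F (M₂ F)) (φ.symm (ε₂ F)) = ε₂ F := φ.apply_symm_apply _
    rw [opAct_apply, this]
    exact coordsM₂_ε₂ x.unop
  act_d x := by
    have : (φ : L →ₗ⁅F⁆ Der F (M₂ F)) (φ.symm (δ₂ F)) = δ₂ F := φ.apply_symm_apply _
    rw [opAct_apply, this]
    exact coordsM₂_δ₂ x.unop

variable {ι : Type*} {b : Basis ι F (UniversalEnvelopingAlgebra F L)}
  {A : Type*} [NonUnitalRing A] [Module F A] [IsScalarTower F A A] [SMulCommClass F A A]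
  {ρ : L →ₗ⁅F⁆ Der F A} {e d : L} {ε δ : UniversalEnvelopingAlgebra F L}

theorem IsRightTriangular.idL_eq_spanTL [Infinite F] {κ : A ≃ₗ[F] F × F}
    (h : IsRightTriangular κ ρ e d) (hε : ε = UniversalEnvelopingAlgebra.ι F e)
    (hδ : δ = UniversalEnvelopingAlgebra.ι F d) :
    idL b ρ = spanTL b {X b 0 1 * X b 1 ε,
      X b 0 ε * X b 1 1 - X b 1 ε * X b 0 1 - (X b 0 1 * X b 1 1 - X b 1 1 * X b 0 1),
      X b 0 (ε ^ 2) - X b 0 ε, X b 0 (δ * ε), X b 0 (ε * δ) - X b 0 δ} := by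
  subst hε hδ
  have hr := h.hasRelations_idL (b := b)
  have hle := spanTL_le b (isTLIdeal_idL b ρ) (S := {_, _, _, _, _}) (by
    rintro f (rfl | rfl | rfl | rfl | rfl)
    exacts [hr.mul_ε, hr.swap_ε, hr.ε_ε, hr.δ_ε, hr.ε_δ])
  refine le_antisymm (h.idL_le ⟨isTLIdeal_spanTL b _, ?_, ?_, ?_, ?_, ?_⟩ hle) hle <;>
    exact subset_spanTL b _ (by simp)

/-- The reversal of the T_L-ideal generated by these polynomials satisfies the relations of the
right triangular case. The completeness result for the opposite algebra therefore applies to it and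
is reversed back. -/
theorem idL_eq_spanTL_of_opAct [Infinite F] {κ : Aᵐᵒᵖ ≃ₗ[F] F × F}
    (h : IsRightTriangular κ (opAct ρ) e d) (hε : ε = UniversalEnvelopingAlgebra.ι F e)
    (hδ : δ = UniversalEnvelopingAlgebra.ι F d) :
    idL b ρ = spanTL b {X b 0 ε * X b 1 1,
      X b 0 1 * X b 1 ε - X b 1 1 * X b 0 ε - (X b 0 1 * X b 1 1 - X b 1 1 * X b 0 1),
      X b 0 (ε ^ 2) - X b 0 ε, X b 0 (δ * ε), X b 0 (ε * δ) - X b 0 δ} := by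
  subst hε hδ
  set ε := UniversalEnvelopingAlgebra.ι F e
  set δ := UniversalEnvelopingAlgebra.ι F d
  set S : Set (FreeDiff F ι) := {X b 0 ε * X b 1 1,
    X b 0 1 * X b 1 ε - X b 1 1 * X b 0 ε - (X b 0 1 * X b 1 1 - X b 1 1 * X b 0 1),
    X b 0 (ε ^ 2) - X b 0 ε, X b 0 (δ * ε), X b 0 (ε * δ) - X b 0 δ} with hS
  have hle : spanTL b S ≤ idL b ρ := by
    refine spanTL_le b (isTLIdeal_idL b ρ) ?_
    have hr := h.hasRelations_idL (b := b)
    rintro f (rfl | rfl | rfl | rfl | rfl) <;>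
      rw [SetLike.mem_coe, ← rev_mem_idL_opAct] <;> simp only [map_sub, rev_mul, rev_X]
    · simpa only [uAct_act_X, mul_one] using hr.mul_act_ε (X b 1 1) (X b 0 1)
    · simpa only [uAct_act_X, mul_one] using hr.swap_act_ε (X b 1 1) (X b 0 1)
    exacts [hr.ε_ε, hr.δ_ε, hr.ε_δ]
  have hT := isTLIdeal_spanTL b S
  have hI : HasRelations b ε δ ((spanTL b S).comap rev) := by
    refine ⟨hT.comap_rev b, ?_, ?_, ?_, ?_, ?_⟩ <;>
      simp only [Submodule.mem_comap, map_sub, rev_mul, rev_X]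
    -- Reversal also exchanges the roles of the two variables; the substitution j ↦ 1 - j swaps x_0
    -- and x_1 back.
    · have := hT.subst_mem b (fun j => X b (1 - j) 1)
        (subset_spanTL b S (show X b 0 ε * X b 1 1 ∈ S by simp [hS]))
      simpa [eval_X, uAct_act_X] using this
    · have := hT.subst_mem b (fun j => X b (1 - j) 1) (subset_spanTL b S
        (show X b 0 1 * X b 1 ε - X b 1 1 * X b 0 ε -
          (X b 0 1 * X b 1 1 - X b 1 1 * X b 0 1) ∈ S by simp [hS]))
      simpa [eval_X, uAct_act_X] using this
    all_goals exact subset_spanTL b S (by simp [hS])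
  refine le_antisymm (fun f hf => ?_) hle
  have hle' : (spanTL b S).comap rev ≤ idL b (opAct ρ) := fun g hg => by
    have := (rev_mem_idL_opAct b ρ).2 (hle hg)
    rwa [rev_rev] at this
  have := h.idL_le hI hle' ((rev_mem_idL_opAct b ρ).2 hf)
  rwa [Submodule.mem_comap, rev_rev] at this

/-- With f the number of fixed points of σ, this is 2 + f = 3·1 + (f - 1). -/
theorem IsRightTriangular.cochar_eq_chi [CharZero F] {κ : A ≃ₗ[F] F × F}
    (h : IsRightTriangular κ ρ e d) {n : ℕ} (hn : 2 ≤ n) :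
    cochar b ρ n = 3 • Specht.chi F n (rowShape n) + Specht.chi F n (hookShape n hn) := by
  funext σ
  rw [h.cochar_eq b (by omega), Pi.add_apply, Pi.smul_apply, Specht.chi_rowShape,
    Specht.chi_hookShape]
  simp only [nsmul_eq_mul]
  push_cast
  ring

theorem IsRightTriangular.cochar_one {κ : A ≃ₗ[F] F × F} (h : IsRightTriangular κ ρ e d) :
    cochar b ρ 1 = 3 • Specht.chi F 1 (rowShape 1) := by
  funext σ
  rw [h.cochar_eq b le_rfl, Pi.smul_apply, Specht.chi_rowShape]
  simp [Subsingleton.elim σ 1]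
  norm_num

end FreeDiff

end Derivations

/-! ### The main theorem. -/

theorem mainTheorem6 {F : Type*} [Field F] [CharZero F]
    {L : Type*} [LieRing L] [LieAlgebra F L]
    (φ₁ : L ≃ₗ⁅F⁆ Der F (M₁ F)) (φ₂ : L ≃ₗ⁅F⁆ Der F (M₂ F))
    {ι : Type*} (b : Module.Basis ι F (UniversalEnvelopingAlgebra F L)) :
    -- the Lie algebras of derivations
    (Module.finrank F (Der F (M₁ F)) = 2 ∧ LieAlgebra.derivedSeries F (Der F (M₁ F)) 2 = ⊥ ∧
      Submodule.span F {ε₁ F, δ₁ F} = ⊤ ∧ ⁅ε₁ F, δ₁ F⁆ = δ₁ F) ∧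
    (Module.finrank F (Der F (M₂ F)) = 2 ∧ LieAlgebra.derivedSeries F (Der F (M₂ F)) 2 = ⊥ ∧
      Submodule.span F {ε₂ F, δ₂ F} = ⊤ ∧ ⁅ε₂ F, δ₂ F⁆ = δ₂ F) ∧
    -- the differential identities of `M₁`
    (∀ ε δ : UniversalEnvelopingAlgebra F L,
      ε = UniversalEnvelopingAlgebra.ι F (φ₁.symm (ε₁ F)) →
      δ = UniversalEnvelopingAlgebra.ι F (φ₁.symm (δ₁ F)) →
      FreeDiff.idL b (φ₁ : L →ₗ⁅F⁆ Der F (M₁ F)) =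
        FreeDiff.spanTL b
          {FreeDiff.X b 0 1 * FreeDiff.X b 1 ε,
            FreeDiff.X b 0 ε * FreeDiff.X b 1 1 - FreeDiff.X b 1 ε * FreeDiff.X b 0 1 -
              (FreeDiff.X b 0 1 * FreeDiff.X b 1 1 - FreeDiff.X b 1 1 * FreeDiff.X b 0 1),
            FreeDiff.X b 0 (ε ^ 2) - FreeDiff.X b 0 ε,
            FreeDiff.X b 0 (δ * ε),
            FreeDiff.X b 0 (ε * δ) - FreeDiff.X b 0 δ}) ∧
    -- the differential identities of `M₂`
    (∀ ε δ : UniversalEnvelopingAlgebra F L,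
      ε = UniversalEnvelopingAlgebra.ι F (φ₂.symm (ε₂ F)) →
      δ = UniversalEnvelopingAlgebra.ι F (φ₂.symm (δ₂ F)) →
      FreeDiff.idL b (φ₂ : L →ₗ⁅F⁆ Der F (M₂ F)) =
        FreeDiff.spanTL b
          {FreeDiff.X b 0 ε * FreeDiff.X b 1 1,
            FreeDiff.X b 0 1 * FreeDiff.X b 1 ε - FreeDiff.X b 1 1 * FreeDiff.X b 0 ε -
              (FreeDiff.X b 0 1 * FreeDiff.X b 1 1 - FreeDiff.X b 1 1 * FreeDiff.X b 0 1),
            FreeDiff.X b 0 (ε ^ 2) - FreeDiff.X b 0 ε,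
            FreeDiff.X b 0 (δ * ε),
            FreeDiff.X b 0 (ε * δ) - FreeDiff.X b 0 δ}) ∧
    -- the differential codimensions
    (∀ n : ℕ, 1 ≤ n →
      FreeDiff.codim b (φ₁ : L →ₗ⁅F⁆ Der F (M₁ F)) n = n + 2 ∧
      FreeDiff.codim b (φ₂ : L →ₗ⁅F⁆ Der F (M₂ F)) n = n + 2) ∧
    -- the differential cocharacters
    (∀ (n : ℕ) (hn : 2 ≤ n),
      FreeDiff.cochar b (φ₁ : L →ₗ⁅F⁆ Der F (M₁ F)) n =
        3 • Specht.chi F n (rowShape n) + Specht.chi F n (hookShape n hn) ∧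
      FreeDiff.cochar b (φ₂ : L →ₗ⁅F⁆ Der F (M₂ F)) n =
        3 • Specht.chi F n (rowShape n) + Specht.chi F n (hookShape n hn)) ∧
    (FreeDiff.cochar b (φ₁ : L →ₗ⁅F⁆ Der F (M₁ F)) 1 = 3 • Specht.chi F 1 (rowShape 1) ∧
      FreeDiff.cochar b (φ₂ : L →ₗ⁅F⁆ Der F (M₂ F)) 1 = 3 • Specht.chi F 1 (rowShape 1)) := by
  have h₁ := FreeDiff.isRightTriangular_M₁ φ₁
  have h₂ := FreeDiff.isRightTriangular_M₂ φ₂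
  refine ⟨Der.structure (κ := coordsM₁ F) (Or.inl M₁_mul_eq) coordsM₁_ε₁ coordsM₁_δ₁,
    Der.structure (κ := coordsM₂ F) (Or.inr M₂_mul_eq) coordsM₂_ε₂ coordsM₂_δ₂,
    fun ε δ hε hδ => h₁.idL_eq_spanTL hε hδ,
    fun ε δ hε hδ => FreeDiff.idL_eq_spanTL_of_opAct h₂ hε hδ,
    fun n hn => ⟨h₁.codim_eq b hn, ?_⟩, fun n hn => ⟨h₁.cochar_eq_chi hn, ?_⟩,
    h₁.cochar_one, ?_⟩
  · rw [← FreeDiff.codim_opAct]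
    exact h₂.codim_eq b hn
  · rw [← FreeDiff.cochar_opAct]
    exact h₂.cochar_eq_chi hn
  · rw [← FreeDiff.cochar_opAct]
    exact h₂.cochar_one
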